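/- Let $p$ be a fixed positive integer, $v\in\mathbb{R}^p$, and let $Q\in\mathbb{R}^{p\times p}$ be either positive definite or zero; $Q$ and $v$ are fixed and define the prior $\omega(\beta)\propto\exp\{-(\beta-v)^TQ(\beta-v)/2\}$ on $\mathbb{R}^p$. Let $\{(X_i,Y_i)\}_{i=1}^\infty$ be random pairs with $X_i\in\mathbb{R}^p$ and $Y_i\in\{0,1\}$, and let $S_1,\dots,S_{2^p}$ be the open orthants of $\mathbb{R}^p$. Assume: (A1) the pairs $(X_i,Y_i)$ are iid with $Y_i\mid X_i\sim\mathrm{Bernoulli}(G(X_i))$, where $G:\mathbb{R}^p\to(0,1)$ is measurable; (A2) $\mathbb{E}X_1X_1^T$ is finite and positive definite; (A3) for every $j\in\{1,\dots,2^p\}$ and every $\beta\neq 0$, $\mathbb{P}\big((1_{S_j}(X_1)+1_{S_j}(-X_1))\,X_1^T\beta\neq 0\big)>0$. For $n\ge 1$ let $\mathcal{D}_n=\{(X_i,Y_i)\}_{i=1}^n$, let $X$ be the $n\times p$ matrix with rows $X_i^T$, and let $\Sigma=X^TX+Q$. Albert and Chib's chain for $\mathcal{D}_n$ is the Markov chain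 on $\mathbb{R}^p$ that moves from $\beta$ to $\beta'$ as follows: draw independent $Z_i$, $i=1,\dots,n$, where $Z_i$ has the $\mathrm{N}(X_i^T\beta,1)$ distribution truncated to $(0,\infty)$ if $Y_i=1$ and to $(-\infty,0)$ if $Y_i=0$; then draw $\beta'\sim\mathrm{N}_p\big(\Sigma^{-1}(X^TZ+Qv),\Sigma^{-1}\big)$. Let $K_n$ be its transition function, and let $\Pi_n$ be the posterior distribution, with density proportional to $\prod_{i=1}^n\Phi(X_i^T\beta)^{Y_i}(1-\Phi(X_i^T\beta))^{1-Y_i}\,\omega(\beta)$, where $\Phi$ is the standard normal distribution function. Let $\rho_*(\mathcal{D}_n)$ be the geometric convergence rate of the chain: the infimum of all $\rho\in[0,1]$ for which there is a function $M:\mathbb{R}^p\to[0,\infty)$ with $\|K_n^m(\beta,\cdot)-\Pi_n\|_{\mathrm{TV}}\le M(\beta)\rho^m$ for all $\beta\in\mathbb{R}^p$ and $m\in\mathbb{N}$ (if the posterior is improper, put $\rho_*(\mathcal{D}_n)=1$). Then there is a constant $\rho<1$ such that, almost surely, $\limsup_{n\to\infty}\rho_*(\mathcal{D}_n)\le\rho$.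 -/

import Mathlib

open MeasureTheory ProbabilityTheory Filter
open scoped Matrix

noncomputable section

namespace AlbertChib

/-- The state space `ℝ^p` with its Euclidean structure. -/
abbrev E (p : ℕ) : Type := EuclideanSpace ℝ (Fin p)

/-! ### Total variation and the geometric convergence rate -/

/-- Total variation distance `sup_A |μ A - ν A|`, the supremum over the measurable sets `A`. -/
def tvDist {S : Type*} [MeasurableSpace S] (μ ν : Measure S) : ℝ :=
  ⨆ A : {A : Set S // MeasurableSet A}, |μ.real A.1 - ν.real A.1|

/-- The geometric convergence rate of a Markov transition function `K` towards `π`: the infimum of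
all `ρ ∈ [0, 1]` for which there is a function `M : S → [0, ∞)` such that
`‖K^m(x, ·) - π‖ ≤ M x * ρ ^ m` for all `x` and `m`. -/
def geometricRate {S : Type*} [MeasurableSpace S] (K : Kernel S S) (π : Measure S) : ℝ :=
  sInf {ρ : ℝ | 0 ≤ ρ ∧ ρ ≤ 1 ∧ ∃ M : S → ℝ, (∀ x, 0 ≤ M x) ∧
    ∀ (x : S) (m : ℕ), tvDist ((K ^ m) x) π ≤ M x * ρ ^ m}

/-! ### The posterior distribution -/

/-- The standard normal distribution function `Φ`. -/
def stdNormalCDF (t : ℝ) : ℝ := cdf (gaussianReal 0 1) t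

/-- The unnormalized posterior density
`{∏ i, Φ(x_iᵀβ)^{y_i} (1 - Φ(x_iᵀβ))^{1 - y_i}} * exp (-(β - v)ᵀ Q (β - v) / 2)` of the Bayesian
probit model; the response `true` is a success. -/
def posteriorWeight {p n : ℕ} (Q : Matrix (Fin p) (Fin p) ℝ) (v : E p)
    (x : Fin n → E p) (y : Fin n → Bool) (β : E p) : ℝ :=
  (∏ i, if y i = true then stdNormalCDF (inner ℝ (x i) β)
      else 1 - stdNormalCDF (inner ℝ (x i) β)) *
    Real.exp (-(1 / 2) * ((⇑(β - v)) ⬝ᵥ (Q *ᵥ ⇑(β - v))))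

/-- The measure whose Lebesgue density is the unnormalized posterior density. -/
def posteriorMass {p n : ℕ} (Q : Matrix (Fin p) (Fin p) ℝ) (v : E p)
    (x : Fin n → E p) (y : Fin n → Bool) : Measure (E p) :=
  (volume : Measure (E p)).withDensity fun β => ENNReal.ofReal (posteriorWeight Q v x y β)

/-- The posterior distribution. It is a probability measure if the posterior is proper
(`posteriorMass` has finite total mass). Otherwise it is the zero measure, and every chain then has
geometric convergence rate `1` with respect to it. -/
def posterior {p n : ℕ} (Q : Matrix (Fin p) (Fin p) ℝ) (v : E p)
    (x : Fin n → E p) (y : Fin n → Bool) : Measure (E p) :=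
  (posteriorMass Q v x y Set.univ)⁻¹ • posteriorMass Q v x y

/-! ### The Markov chain of Albert and Chib -/

/-- The half line to which the latent variable of a response is restricted. -/
def halfLine (b : Bool) : Set ℝ := if b = true then Set.Ioi 0 else Set.Iio 0

/-- `TN(θ, 1; b)`: the `N(θ, 1)` distribution truncated to `(0, ∞)` if `b = true`, and to
`(-∞, 0)` if `b = false`. -/
def truncNormal (θ : ℝ) (b : Bool) : Measure ℝ :=
  ProbabilityTheory.cond (gaussianReal θ 1) (halfLine b)

lemma measurableSet_halfLine (b : Bool) : MeasurableSet (halfLine b) := by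
  unfold halfLine
  split_ifs
  exacts [measurableSet_Ioi, measurableSet_Iio]

instance isProbabilityMeasure_truncNormal (θ : ℝ) (b : Bool) :
    IsProbabilityMeasure (truncNormal θ b) := by
  apply ProbabilityTheory.cond_isProbabilityMeasure
  intro h
  have h0 : (volume : Measure ℝ) (halfLine b) = 0 :=
    gaussianReal_absolutelyContinuous' θ one_ne_zero h
  unfold halfLine at h0
  split_ifs at h0 <;> simp at h0

lemma measurable_truncNormal (b : Bool) : Measurable fun θ : ℝ => truncNormal θ b := by
  have hg (s : Set ℝ) (hs : MeasurableSet s) : Measurable fun θ : ℝ => gaussianReal θ 1 s := by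
    have h (θ : ℝ) : gaussianReal θ 1 s =
        gaussianReal 0 1 (Prod.mk θ ⁻¹' ((fun q : ℝ × ℝ => q.1 + q.2) ⁻¹' s)) := by
      conv_lhs => rw [← add_zero θ, add_comm θ 0, ← gaussianReal_map_const_add θ]
      rw [Measure.map_apply (by fun_prop) hs]
      rfl
    simp_rw [h]
    exact measurable_measure_prodMk_left
      ((by fun_prop : Measurable fun q : ℝ × ℝ => q.1 + q.2) hs)
  refine Measure.measurable_of_measurable_coe _ fun s hs => ?_
  simp_rw [truncNormal, ProbabilityTheory.cond_apply (measurableSet_halfLine b)]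
  exact (hg _ (measurableSet_halfLine b)).inv.mul (hg _ ((measurableSet_halfLine b).inter hs))

/-- The conditional law of the latent vector `Z = (Z_1, …, Z_n)` given `β`: independent coordinates
`Z_i ∼ TN(x_iᵀβ, 1; y_i)`. -/
def latentKernel {p n : ℕ} (x : Fin n → E p) (y : Fin n → Bool) :
    Kernel (E p) (Fin n → ℝ) where
  toFun β := Measure.pi fun i => truncNormal (inner ℝ (x i) β) (y i)
  measurable' := by
    refine .measure_of_isPiSystem_of_isProbabilityMeasure generateFrom_pi.symm isPiSystem_pi ?_
    rintro _ ⟨s, hs, rfl⟩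
    simp_rw [Measure.pi_pi]
    refine Finset.measurable_prod _ fun i _ => ?_
    have h : Measurable fun β : E p => truncNormal (inner ℝ (x i) β) (y i) :=
      (measurable_truncNormal (y i)).comp (by fun_prop)
    exact (Measure.measurable_coe (show MeasurableSet (s i) from hs i (Set.mem_univ i))).comp h

/-- The design matrix, whose `i`-th row is `x_iᵀ`. -/
def designMatrix {p n : ℕ} (x : Fin n → E p) : Matrix (Fin n) (Fin p) ℝ :=
  Matrix.of fun i k => x i k

/-- The matrix `Σ = XᵀX + Q`. -/
def precision {p n : ℕ} (Q : Matrix (Fin p) (Fin p) ℝ) (x : Fin n → E p) :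
    Matrix (Fin p) (Fin p) ℝ :=
  (designMatrix x)ᵀ * designMatrix x + Q

/-- The conditional mean `Σ⁻¹ (Xᵀ z + Q v)` of the regression coefficients. -/
def coefMean {p n : ℕ} (Q : Matrix (Fin p) (Fin p) ℝ) (v : E p)
    (x : Fin n → E p) (z : Fin n → ℝ) : E p :=
  WithLp.toLp 2 ((precision Q x)⁻¹ *ᵥ ((designMatrix x)ᵀ *ᵥ z + Q *ᵥ ⇑v))

/-- The conditional law of the regression coefficients given the latent vector `z`:
`N_p(Σ⁻¹ (Xᵀ z + Q v), Σ⁻¹)`. -/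
def coefKernel {p n : ℕ} (Q : Matrix (Fin p) (Fin p) ℝ) (v : E p) (x : Fin n → E p) :
    Kernel (Fin n → ℝ) (E p) where
  toFun z := multivariateGaussian (coefMean Q v x z) (precision Q x)⁻¹
  measurable' := by
    refine Measure.measurable_of_measurable_coe _ fun s hs => ?_
    have hm : Measurable (coefMean Q v x) := by
      refine Continuous.measurable ?_
      unfold coefMean
      fun_prop
    obtain ⟨L, hL⟩ : ∃ L : E p →L[ℝ] E p, ∀ m : E p,
        multivariateGaussian m (precision Q x)⁻¹ = (stdGaussian (E p)).map fun w => m + L w :=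
      ⟨_, fun _ => rfl⟩
    have hf (z : Fin n → ℝ) := Measure.map_apply (μ := stdGaussian (E p))
      (f := fun w => coefMean Q v x z + L w) (by fun_prop) hs
    simp_rw [hL, hf]
    exact measurable_measure_prodMk_left ((show Measurable fun q : (Fin n → ℝ) × E p =>
      coefMean Q v x q.1 + L q.2 from (hm.comp measurable_fst).add (by fun_prop)) hs)

/-- The transition function of Albert and Chib's chain: from `β`, draw `z` from the conditional law
of the latent vector given `β`, then draw the new state from the conditional law of the
coefficients given `z`. -/
def chain {p n : ℕ} (Q : Matrix (Fin p) (Fin p) ℝ) (v : E p)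
    (x : Fin n → E p) (y : Fin n → Bool) : Kernel (E p) (E p) :=
  coefKernel Q v x ∘ₖ latentKernel x y

/-- The geometric convergence rate of Albert and Chib's chain for the prior parameters `Q`, `v` and
the data set `(x_i, y_i)`, `i = 1, …, n`. -/
def rate {p n : ℕ} (Q : Matrix (Fin p) (Fin p) ℝ) (v : E p)
    (x : Fin n → E p) (y : Fin n → Bool) : ℝ :=
  geometricRate (chain Q v x y) (posterior Q v x y)

/-! ### Orthants -/

/-- The open orthants of `ℝ^p`, indexed by the `2 ^ p` sign patterns `j` (`true` is positive). -/
def orthant {p : ℕ} (j : Fin p → Bool) : Set (E p) :=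
  {x | ∀ k, if j k = true then 0 < x k else x k < 0}

end AlbertChib

end

/-! The chain contracts in a Wasserstein sense for the norm `‖b‖_Σ² = quad (precision Q x) b`, and
the law of large numbers keeps the contraction factor away from 1.

One step. Run two copies from `β` and `β'` with the same uniform variables behind the latent
variables (quantile coupling). Each latent coordinate is monotone and 1-Lipschitz in `x_iᵀβ`, so `|Z
- Z'|²` is at most `∑ x_iᵀ(β - β') (Z_i - Z'_i)` (`sq_latentQuantile_sub_le`), whose expectation
involves only truncated means. The derivative of a truncated mean is the truncated variance. It is
always below 1, and at most 1/2 when the response contradicts the sign of `x_iᵀβ`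
(`half_le_mills_mul_truncMean`). If in every orthant such discordant observations carry a proportion
`c` of the form of `Σ`, the expectation is at most `(1 - c/2) ‖β - β'‖_Σ²`
(`sum_inner_mul_latentMean_sub_le`). Passing from `z` to the conditional mean of the coefficients
does not increase distances (`quad_coefMean_sub_le`), so the step contracts by `√(1 - c/2)`.

From contraction to total variation. The final Gaussian draw makes probabilities Lipschitz in its
mean, so two chains differ after `m` steps by at most a constant times `√(1 - c/2)^m ‖β - β'‖_Σ`
(`abs_chain_pow_real_sub_le`). Averaging `β'` over the posterior, which is invariant and dominated
by a multiple of a Gaussian, gives `rate_le`.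

Asymptotics. There are only `2^p` orthants. For each, the averaged discordant form converges almost
surely to a form that is positive definite by (A3) and `0 < G < 1` (`integral_discordantSq_pos`),
while `Σ / n` stays bounded. Hence one deterministic `c > 0` serves all large `n`
(`exists_eventually_rate_le`). -/

noncomputable section

namespace AlbertChib

open scoped Topology ENNReal

/-! ### The standard normal distribution function and the inverse Mills ratio -/

/-- The standard normal density. -/
def stdNormalPDF (t : ℝ) : ℝ := gaussianPDFReal 0 1 t

lemma stdNormalPDF_eq (t : ℝ) :
    stdNormalPDF t = (√(2 * Real.pi))⁻¹ * Real.exp (-t ^ 2 / 2) := by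
  simp [stdNormalPDF, gaussianPDFReal]

lemma stdNormalPDF_pos (t : ℝ) : 0 < stdNormalPDF t :=
  gaussianPDFReal_pos _ _ _ one_ne_zero

lemma stdNormalPDF_neg (t : ℝ) : stdNormalPDF (-t) = stdNormalPDF t := by
  simp [stdNormalPDF_eq]

lemma hasDerivAt_stdNormalPDF (t : ℝ) : HasDerivAt stdNormalPDF (-t * stdNormalPDF t) t := by
  have h1 : HasDerivAt (fun t : ℝ => -t ^ 2 / 2) (-t) t := by
    have := ((hasDerivAt_pow 2 t).neg).div_const 2
    exact this.congr_deriv (by push_cast; ring)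
  have h2 := (h1.exp).const_mul (√(2 * Real.pi))⁻¹
  have h3 : stdNormalPDF = fun t => (√(2 * Real.pi))⁻¹ * Real.exp (-t ^ 2 / 2) :=
    funext stdNormalPDF_eq
  rw [h3]
  exact h2.congr_deriv (by ring)

lemma continuous_stdNormalPDF : Continuous stdNormalPDF :=
  continuous_iff_continuousAt.2 fun t => (hasDerivAt_stdNormalPDF t).continuousAt

lemma stdNormalPDF_le (t : ℝ) : √2 * stdNormalPDF t ≤ Real.exp (-t ^ 2 / 2) := by
  rw [stdNormalPDF_eq, ← mul_assoc]
  refine mul_le_of_le_one_left (Real.exp_pos _).le ?_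
  rw [← div_eq_mul_inv]
  refine div_le_one_of_le₀ (Real.sqrt_le_sqrt ?_) (Real.sqrt_nonneg _)
  linarith [Real.pi_gt_three]

lemma tendsto_stdNormalPDF_cocompact : Tendsto stdNormalPDF (cocompact ℝ) (𝓝 0) := by
  have h := tendsto_rpow_abs_mul_exp_neg_mul_sq_cocompact (a := 1 / 2) (by norm_num) 0
  have h2 := h.const_mul (√(2 * Real.pi))⁻¹
  rw [mul_zero] at h2
  refine h2.congr fun t => ?_
  rw [stdNormalPDF_eq]
  simp only [Real.rpow_zero, one_mul]
  congr 2
  ring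

lemma gaussianPDFReal_eq_stdNormalPDF (θ z : ℝ) :
    gaussianPDFReal θ 1 z = stdNormalPDF (z - θ) := by
  simp [stdNormalPDF, gaussianPDFReal]

lemma stdNormalCDF_eq_integral (t : ℝ) : stdNormalCDF t = ∫ z in Set.Iic t, stdNormalPDF z := by
  rw [stdNormalCDF, cdf_eq_real, measureReal_def, gaussianReal_apply_eq_integral _ one_ne_zero,
    ENNReal.toReal_ofReal]
  · rfl
  · exact integral_nonneg fun z => gaussianPDFReal_nonneg _ _ _

lemma integrable_stdNormalPDF : Integrable stdNormalPDF := integrable_gaussianPDFReal 0 1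

lemma hasDerivAt_stdNormalCDF (t : ℝ) : HasDerivAt stdNormalCDF (stdNormalPDF t) t := by
  have h1 : ∀ s, stdNormalCDF s = stdNormalCDF 0 + ∫ z in (0 : ℝ)..s, stdNormalPDF z := by
    intro s
    rw [stdNormalCDF_eq_integral, stdNormalCDF_eq_integral, ← intervalIntegral.integral_Iic_sub_Iic
      integrable_stdNormalPDF.integrableOn integrable_stdNormalPDF.integrableOn]
    ring
  rw [funext h1]
  exact (intervalIntegral.integral_hasDerivAt_right
    (integrable_stdNormalPDF.intervalIntegrable)
    continuous_stdNormalPDF.stronglyMeasurable.stronglyMeasurableAtFilter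
    continuous_stdNormalPDF.continuousAt).const_add _

lemma strictMono_stdNormalCDF : StrictMono stdNormalCDF :=
  strictMono_of_hasDerivAt_pos hasDerivAt_stdNormalCDF stdNormalPDF_pos

lemma continuous_stdNormalCDF : Continuous stdNormalCDF :=
  continuous_iff_continuousAt.2 fun t => (hasDerivAt_stdNormalCDF t).continuousAt

lemma stdNormalCDF_pos (t : ℝ) : 0 < stdNormalCDF t :=
  (cdf_nonneg _ (t - 1)).trans_lt (strictMono_stdNormalCDF (sub_one_lt t))

lemma stdNormalCDF_lt_one (t : ℝ) : stdNormalCDF t < 1 :=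
  (strictMono_stdNormalCDF (lt_add_one t)).trans_le (cdf_le_one _ (t + 1))

lemma tendsto_stdNormalCDF_atBot : Tendsto stdNormalCDF atBot (𝓝 0) := tendsto_cdf_atBot _

lemma tendsto_stdNormalCDF_atTop : Tendsto stdNormalCDF atTop (𝓝 1) := tendsto_cdf_atTop _

/-- The sum of both sides' `Φ` terms has zero derivative, and its limit at infinity is 1. -/
lemma stdNormalCDF_neg (t : ℝ) : stdNormalCDF (-t) = 1 - stdNormalCDF t := by
  have h : ∀ s, HasDerivAt (fun s => stdNormalCDF (-s) + stdNormalCDF s) 0 s := by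
    intro s
    have := ((hasDerivAt_stdNormalCDF (-s)).comp s (hasDerivAt_neg s)).add
      (hasDerivAt_stdNormalCDF s)
    exact this.congr_deriv (by rw [stdNormalPDF_neg]; ring)
  have hc : ∀ s, stdNormalCDF (-s) + stdNormalCDF s = stdNormalCDF (-t) + stdNormalCDF t :=
    fun s => is_const_of_deriv_eq_zero (fun s => (h s).differentiableAt) (fun s => (h s).deriv) s t
  have hl : Tendsto (fun s => stdNormalCDF (-s) + stdNormalCDF s) atTop (𝓝 (0 + 1)) :=
    (tendsto_stdNormalCDF_atBot.comp tendsto_neg_atTop_atBot).add tendsto_stdNormalCDF_atTop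
  simp_rw [hc] at hl
  have := tendsto_nhds_unique hl tendsto_const_nhds
  linarith

/-- An upper bound for the lower tail of the standard normal distribution. -/
lemma stdNormalCDF_le_mul {t : ℝ} (ht : t ≤ 0) :
    stdNormalCDF t ≤ stdNormalPDF t * (√(t ^ 2 + 2) + t) := by
  -- The gap `D` vanishes at `-∞` and is nondecreasing on the negative half line, hence nonnegative
  -- there.
  set D : ℝ → ℝ := fun t => stdNormalPDF t * (√(t ^ 2 + 2) + t) - stdNormalCDF t with hD
  have hs : ∀ t : ℝ, 0 < t ^ 2 + 2 := fun t => by positivity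
  have hder : ∀ t, HasDerivAt D
      (stdNormalPDF t * -t * (√(t ^ 2 + 2) + t - 1 / √(t ^ 2 + 2))) t := by
    intro t
    have h1 : HasDerivAt (fun t : ℝ => t ^ 2 + 2) (2 * t) t := by
      simpa using (hasDerivAt_pow 2 t).add_const 2
    have h2 := (h1.sqrt (hs t).ne').add (hasDerivAt_id t)
    have h3 := ((hasDerivAt_stdNormalPDF t).mul h2).sub (hasDerivAt_stdNormalCDF t)
    refine h3.congr_deriv ?_
    have : √(t ^ 2 + 2) ≠ 0 := (Real.sqrt_pos.2 (hs t)).ne'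
    simp only [Pi.add_apply, id]
    field_simp
    ring
  have hmono : MonotoneOn D (Set.Iic 0) := by
    refine monotoneOn_of_deriv_nonneg (convex_Iic 0)
      (fun t _ => (hder t).continuousAt.continuousWithinAt)
      (fun t _ => (hder t).differentiableAt.differentiableWithinAt) fun t ht => ?_
    rw [interior_Iic] at ht
    have ht : t < 0 := ht
    rw [(hder t).deriv]
    refine mul_nonneg (mul_nonneg (stdNormalPDF_pos t).le (by linarith)) ?_
    have hp := Real.sqrt_pos.2 (hs t)
    have hsq := Real.sq_sqrt (hs t).le
    rw [sub_nonneg, div_le_iff₀ hp]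
    -- AM-GM for `√(t² + 2)` and `-t`.
    have h2 : √(t ^ 2 + 2) * -t ≤ t ^ 2 + 1 := by
      nlinarith [sq_nonneg (√(t ^ 2 + 2) - -t)]
    nlinarith
  have hlim : Tendsto D atBot (𝓝 0) := by
    have h0 : Tendsto (fun t => stdNormalPDF t * (√(t ^ 2 + 2) + t)) atBot (𝓝 0) := by
      have hφ : Tendsto (fun t => stdNormalPDF t * √2) atBot (𝓝 0) := by
        simpa using (tendsto_stdNormalPDF_cocompact.mono_left atBot_le_cocompact).mul_const (√2)
      refine squeeze_zero' (Eventually.of_forall fun t => ?_)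
        ((eventually_le_atBot 0).mono fun t ht => ?_) hφ
      · refine mul_nonneg (stdNormalPDF_pos t).le ?_
        have : -t ≤ √(t ^ 2 + 2) := Real.le_sqrt_of_sq_le (by nlinarith)
        linarith
      · refine mul_le_mul_of_nonneg_left ?_ (stdNormalPDF_pos t).le
        have : √(t ^ 2 + 2) ≤ √2 + -t := by
          refine Real.sqrt_le_iff.2 ⟨by have := Real.sqrt_nonneg 2; linarith, ?_⟩
          nlinarith [Real.sq_sqrt (show (0 : ℝ) ≤ 2 by norm_num), Real.sqrt_nonneg 2]
        linarith
    simpa using h0.sub tendsto_stdNormalCDF_atBot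
  have : 0 ≤ D t := le_of_tendsto hlim ((eventually_le_atBot t).mono fun s hs' =>
    hmono (hs'.trans ht) ht hs')
  simpa [hD] using this

/-- On the negative half line `√(t² + 2) + t ≤ √2`, and `√2 φ` is below the exponential. This gives
the Gaussian decay of the likelihood factors of discordant observations. -/
lemma stdNormalCDF_le_exp {t : ℝ} (ht : t ≤ 0) : stdNormalCDF t ≤ Real.exp (-t ^ 2 / 2) := by
  refine (stdNormalCDF_le_mul ht).trans (le_trans ?_ (stdNormalPDF_le t))
  rw [mul_comm]
  refine mul_le_mul_of_nonneg_right ?_ (stdNormalPDF_pos t).le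
  have : √(t ^ 2 + 2) ≤ √2 + -t := by
    refine Real.sqrt_le_iff.2 ⟨by have := Real.sqrt_nonneg 2; linarith, ?_⟩
    nlinarith [Real.sq_sqrt (show (0 : ℝ) ≤ 2 by norm_num), Real.sqrt_nonneg 2]
  linarith

/-- The inverse Mills ratio `φ / Φ`. -/
def mills (t : ℝ) : ℝ := stdNormalPDF t / stdNormalCDF t

lemma mills_pos (t : ℝ) : 0 < mills t := div_pos (stdNormalPDF_pos t) (stdNormalCDF_pos t)

lemma hasDerivAt_mills (t : ℝ) : HasDerivAt mills (-(mills t * (t + mills t))) t := by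
  have h := (hasDerivAt_stdNormalPDF t).div (hasDerivAt_stdNormalCDF t) (stdNormalCDF_pos t).ne'
  refine h.congr_deriv ?_
  have := (stdNormalCDF_pos t).ne'
  simp only [mills]
  field_simp
  ring

/-- The tail bound rationalized, using `(√(t² + 2) - t)(√(t² + 2) + t) = 2`. -/
lemma le_mills {t : ℝ} (ht : t ≤ 0) : (√(t ^ 2 + 2) - t) / 2 ≤ mills t := by
  rw [mills, le_div_iff₀ (stdNormalCDF_pos t)]
  have h := stdNormalCDF_le_mul ht
  have hs : 0 ≤ √(t ^ 2 + 2) - t := by linarith [Real.sqrt_nonneg (t ^ 2 + 2)]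
  have hsq := Real.sq_sqrt (show 0 ≤ t ^ 2 + 2 by positivity)
  calc (√(t ^ 2 + 2) - t) / 2 * stdNormalCDF t
      ≤ (√(t ^ 2 + 2) - t) / 2 * (stdNormalPDF t * (√(t ^ 2 + 2) + t)) := by gcongr
    _ = stdNormalPDF t * ((√(t ^ 2 + 2)) ^ 2 - t ^ 2) / 2 := by ring
    _ = stdNormalPDF t := by rw [hsq]; ring

/-- The mean `t + φ t / Φ t` of the `N(t, 1)` distribution truncated to the positive half line. -/
def truncMean (t : ℝ) : ℝ := t + mills t

/-- The lower bound of `le_mills` for `mills t` gives one for `t + mills t`, and the product of the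
two is `((t² + 2) - t²) / 4`. Equivalently, truncation to a half line that does not contain the mean
in its interior leaves variance at most 1/2; this is the source of the contraction. -/
lemma half_le_mills_mul_truncMean {t : ℝ} (ht : t ≤ 0) : 1 / 2 ≤ mills t * truncMean t := by
  have h := le_mills ht
  have hsq := Real.sq_sqrt (show 0 ≤ t ^ 2 + 2 by positivity)
  have hs : -t ≤ √(t ^ 2 + 2) := Real.le_sqrt_of_sq_le (by nlinarith)
  have h2 : (√(t ^ 2 + 2) + t) / 2 ≤ truncMean t := by rw [truncMean]; linarith
  calc (1 : ℝ) / 2 = (√(t ^ 2 + 2) - t) / 2 * ((√(t ^ 2 + 2) + t) / 2) := by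
        linear_combination -hsq / 4
    _ ≤ mills t * truncMean t := mul_le_mul h h2 (by linarith) (mills_pos t).le

lemma truncMean_pos (t : ℝ) : 0 < truncMean t := by
  rcases le_total t 0 with ht | ht
  · exact pos_of_mul_pos_right ((by norm_num : (0 : ℝ) < 1 / 2).trans_le
      (half_le_mills_mul_truncMean ht)) (mills_pos t).le
  · exact add_pos_of_nonneg_of_pos ht (mills_pos t)

lemma antitone_mills : Antitone mills :=
  antitone_of_hasDerivAt_nonpos hasDerivAt_mills fun t =>
    neg_nonpos.2 (mul_pos (mills_pos t) (truncMean_pos t)).le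

/-- The derivative is the variance of the truncated law. -/
lemma hasDerivAt_truncMean (t : ℝ) :
    HasDerivAt truncMean (1 - mills t * truncMean t) t := by
  have := (hasDerivAt_id t).add (hasDerivAt_mills t)
  exact this

/-- Log-concavity of the standard normal distribution function. -/
lemma stdNormalCDF_sub_div_mono {t : ℝ} (ht : 0 ≤ t) :
    Monotone fun θ => stdNormalCDF (θ - t) / stdNormalCDF θ := by
  have hd : ∀ θ, HasDerivAt (fun θ => stdNormalCDF (θ - t) / stdNormalCDF θ)
      (stdNormalCDF (θ - t) / stdNormalCDF θ * (mills (θ - t) - mills θ)) θ := by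
    intro θ
    have h := ((hasDerivAt_stdNormalCDF (θ - t)).comp_sub_const θ t).div
      (hasDerivAt_stdNormalCDF θ) (stdNormalCDF_pos θ).ne'
    refine h.congr_deriv ?_
    have := (stdNormalCDF_pos θ).ne'
    have := (stdNormalCDF_pos (θ - t)).ne'
    simp only [mills]
    field_simp
  refine monotone_of_hasDerivAt_nonneg hd fun θ => ?_
  exact mul_nonneg (div_nonneg (stdNormalCDF_pos _).le (stdNormalCDF_pos _).le)
    (sub_nonneg.2 (antitone_mills (by linarith)))

/-! ### Quantile functions -/

/-- The uniform distribution on the unit interval. -/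
def unifUnit : Measure ℝ := volume.restrict (Set.Ioo 0 1)

instance isProbabilityMeasure_unifUnit : IsProbabilityMeasure unifUnit :=
  ⟨by simp [unifUnit]⟩

/-- The quantile function of a probability measure on the line, set to zero outside `(0, 1)`. -/
def quantile (μ : Measure ℝ) (u : ℝ) : ℝ :=
  if u ∈ Set.Ioo (0 : ℝ) 1 then sInf {t | u ≤ cdf μ t} else 0

/-- Right continuity of the distribution function makes the infimum attained. The other facts about
quantiles follow from this Galois connection. -/
lemma quantile_le_iff (μ : Measure ℝ) {u : ℝ} (hu : u ∈ Set.Ioo (0 : ℝ) 1) (t : ℝ) :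
    quantile μ u ≤ t ↔ u ≤ cdf μ t := by
  have hne : {t | u ≤ cdf μ t}.Nonempty :=
    (((tendsto_cdf_atTop μ).eventually_const_lt hu.2).exists).imp fun _ h => h.le
  have hbdd : BddBelow {t | u ≤ cdf μ t} := by
    obtain ⟨a, ha⟩ := ((tendsto_cdf_atBot μ).eventually_lt_const hu.1).exists
    exact ⟨a, fun t ht => le_of_not_gt fun h => absurd (ht.trans (monotone_cdf μ h.le)) ha.not_ge⟩
  rw [quantile, if_pos hu]
  refine ⟨fun h => ?_, fun h => csInf_le hbdd h⟩
  have hgt : ∀ s, t < s → u ≤ cdf μ s := fun s hs => by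
    obtain ⟨r, hr, hrs⟩ := exists_lt_of_csInf_lt hne (h.trans_lt hs)
    exact hr.trans (monotone_cdf μ hrs.le)
  have hc : Tendsto (cdf μ) (𝓝[>] t) (𝓝 (cdf μ t)) :=
    ((cdf μ).right_continuous t).tendsto.mono_left (nhdsWithin_mono _ Set.Ioi_subset_Ici_self)
  exact ge_of_tendsto hc (eventually_nhdsWithin_of_forall hgt)

lemma measurable_quantile (μ : Measure ℝ) : Measurable (quantile μ) := by
  refine measurable_of_Iic fun t => ?_
  have : quantile μ ⁻¹' Set.Iic t = (Set.Ioo 0 1 ∩ Set.Iic (cdf μ t)) ∪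
      ((Set.Ioo 0 1)ᶜ ∩ {_u | (0 : ℝ) ≤ t}) := by
    ext u
    by_cases hu : u ∈ Set.Ioo (0 : ℝ) 1
    · simp only [Set.mem_preimage, Set.mem_Iic, quantile_le_iff μ hu, Set.mem_union,
        Set.mem_inter_iff, hu, Set.mem_compl_iff, not_true, true_and, false_and, or_false]
    · simp [quantile, hu]
  rw [this]
  exact (measurableSet_Ioo.inter measurableSet_Iic).union
    (measurableSet_Ioo.compl.inter (MeasurableSet.const _))

lemma map_quantile (μ : Measure ℝ) [IsProbabilityMeasure μ] :
    unifUnit.map (quantile μ) = μ := by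
  have hm := measurable_quantile μ
  have : IsProbabilityMeasure (unifUnit.map (quantile μ)) :=
    Measure.isProbabilityMeasure_map hm.aemeasurable
  refine Measure.ext_of_Iic _ _ fun t => ?_
  rw [Measure.map_apply hm measurableSet_Iic, ← ofReal_cdf μ t, unifUnit,
    Measure.restrict_apply (hm measurableSet_Iic)]
  have h1 : quantile μ ⁻¹' Set.Iic t ∩ Set.Ioo 0 1 = Set.Ioo 0 1 ∩ Set.Iic (cdf μ t) := by
    ext u
    constructor
    · rintro ⟨h, hu⟩
      exact ⟨hu, (quantile_le_iff μ hu t).1 h⟩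
    · rintro ⟨hu, h⟩
      exact ⟨(quantile_le_iff μ hu t).2 h, hu⟩
  have h2 : (Set.Ioo 0 1 ∩ Set.Iic (cdf μ t) : Set ℝ) =ᵐ[volume] Set.Ioc 0 (cdf μ t) := by
    refine (Ioo_ae_eq_Ioc.inter (ae_eq_refl _)).trans (ae_of_all _ fun u => ?_)
    refine propext ⟨fun h => ⟨h.1.1, h.2⟩, fun h => ⟨⟨h.1, h.2.trans (cdf_le_one μ t)⟩, h.2⟩⟩
  rw [h1, measure_congr h2, Real.volume_Ioc, sub_zero]

/-- Stochastic order becomes pointwise order when both laws are driven by the same uniform variable.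
-/
lemma quantile_mono {μ ν : Measure ℝ} (h : ∀ t, cdf ν t ≤ cdf μ t) (u : ℝ) :
    quantile μ u ≤ quantile ν u := by
  by_cases hu : u ∈ Set.Ioo (0 : ℝ) 1
  · exact (quantile_le_iff μ hu _).2 (((quantile_le_iff ν hu _).1 le_rfl).trans (h _))
  · simp [quantile, hu]

lemma quantile_le_add {μ ν : Measure ℝ} {δ : ℝ} (hδ : 0 ≤ δ) (h : ∀ t, cdf μ t ≤ cdf ν (t + δ))
    (u : ℝ) : quantile ν u ≤ quantile μ u + δ := by
  by_cases hu : u ∈ Set.Ioo (0 : ℝ) 1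
  · exact (quantile_le_iff ν hu _).2 (((quantile_le_iff μ hu _).1 le_rfl).trans (h _))
  · simp [quantile, hu, hδ]

/-! ### Truncated normal distributions -/

lemma gaussianReal_eq_map (θ : ℝ) : gaussianReal θ 1 = (gaussianReal 0 1).map (· + θ) := by
  rw [gaussianReal_map_add_const, zero_add]

lemma gaussianReal_real_Iic (θ t : ℝ) :
    (gaussianReal θ 1).real (Set.Iic t) = stdNormalCDF (t - θ) := by
  rw [stdNormalCDF, cdf_eq_real, gaussianReal_eq_map,
    map_measureReal_apply (measurable_add_const θ) measurableSet_Iic]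
  congr 1
  ext z
  simp [le_sub_iff_add_le]

lemma gaussianReal_real_Ioi (θ t : ℝ) :
    (gaussianReal θ 1).real (Set.Ioi t) = stdNormalCDF (θ - t) := by
  rw [← Set.compl_Iic, probReal_compl_eq_one_sub measurableSet_Iic, gaussianReal_real_Iic,
    ← stdNormalCDF_neg, neg_sub]

lemma gaussianReal_real_Iio (θ t : ℝ) :
    (gaussianReal θ 1).real (Set.Iio t) = stdNormalCDF (t - θ) := by
  have : NullSingletonClass (gaussianReal θ 1) := nullSingletonClass_gaussianReal one_ne_zero
  rw [← gaussianReal_real_Iic]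
  exact measureReal_congr Iio_ae_eq_Iic

/-- The sign of a response. -/
def sgn (b : Bool) : ℝ := if b = true then 1 else -1

lemma gaussianReal_real_halfLine (θ : ℝ) (b : Bool) :
    (gaussianReal θ 1).real (halfLine b) = stdNormalCDF (sgn b * θ) := by
  cases b
  · simp [halfLine, sgn, gaussianReal_real_Iio]
  · simp [halfLine, sgn, gaussianReal_real_Ioi]

lemma truncNormal_real_apply (θ : ℝ) (b : Bool) (s : Set ℝ) :
    (truncNormal θ b).real s =
      (gaussianReal θ 1).real (halfLine b ∩ s) / stdNormalCDF (sgn b * θ) := by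
  rw [measureReal_def, truncNormal, cond_apply (measurableSet_halfLine b), ENNReal.toReal_mul,
    ENNReal.toReal_inv, ← gaussianReal_real_halfLine, div_eq_inv_mul]
  rfl

lemma cdf_truncNormal_true (θ t : ℝ) :
    cdf (truncNormal θ true) t = 1 - stdNormalCDF (θ - max 0 t) / stdNormalCDF θ := by
  rw [cdf_eq_real, ← Set.compl_Ioi, probReal_compl_eq_one_sub measurableSet_Ioi,
    truncNormal_real_apply]
  simp [halfLine, Set.Ioi_inter_Ioi, gaussianReal_real_Ioi, sgn]

lemma cdf_truncNormal_false (θ t : ℝ) :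
    cdf (truncNormal θ false) t = stdNormalCDF (min 0 t - θ) / stdNormalCDF (-θ) := by
  rw [cdf_eq_real, truncNormal_real_apply]
  have : (gaussianReal θ 1).real (Set.Iio 0 ∩ Set.Iic t) = stdNormalCDF (min 0 t - θ) := by
    rcases le_or_gt 0 t with h | h
    · rw [min_eq_left h, ← gaussianReal_real_Iio]
      congr 1
      ext z; simp; intro hz; linarith
    · rw [min_eq_right h.le, ← gaussianReal_real_Iic]
      congr 1
      ext z; simp; intro hz; linarith
  simp [halfLine, this, sgn]

/-- Stochastic monotonicity in `θ`, a consequence of the log-concavity of `Φ`. -/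
lemma cdf_truncNormal_anti {θ θ' : ℝ} (h : θ ≤ θ') (b : Bool) (t : ℝ) :
    cdf (truncNormal θ' b) t ≤ cdf (truncNormal θ b) t := by
  cases b
  · rw [cdf_truncNormal_false, cdf_truncNormal_false]
    have := stdNormalCDF_sub_div_mono (t := -min 0 t) (by simp) (neg_le_neg h)
    simpa [sub_eq_add_neg, add_comm] using this
  · rw [cdf_truncNormal_true, cdf_truncNormal_true]
    have := stdNormalCDF_sub_div_mono (t := max 0 t) (by simp) h
    exact sub_le_sub_left this 1

/-- After the shift by `θ' - θ` the untruncated probabilities coincide, so only the normalizing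
constants are compared. Where the shift carries the argument across the truncation point, one side
is trivial. -/
lemma cdf_truncNormal_le_add {θ θ' : ℝ} (h : θ ≤ θ') (b : Bool) (t : ℝ) :
    cdf (truncNormal θ b) t ≤ cdf (truncNormal θ' b) (t + (θ' - θ)) := by
  have hp := stdNormalCDF_pos
  cases b
  · rw [cdf_truncNormal_false, cdf_truncNormal_false]
    rcases le_total (t + (θ' - θ)) 0 with h0 | h0
    · rw [min_eq_right h0, min_eq_right (by linarith : t ≤ 0)]
      rw [show t + (θ' - θ) - θ' = t - θ by ring]
      exact div_le_div_of_nonneg_left (hp _).le (hp _)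
        (strictMono_stdNormalCDF.monotone (by linarith))
    · rw [min_eq_left h0, zero_sub, div_self (hp _).ne']
      refine div_le_one_of_le₀ (strictMono_stdNormalCDF.monotone ?_) (hp _).le
      linarith [min_le_left 0 t]
  · rw [cdf_truncNormal_true, cdf_truncNormal_true]
    refine sub_le_sub_left ?_ 1
    rcases le_total 0 t with h0 | h0
    · rw [max_eq_right h0, max_eq_right (by linarith : 0 ≤ t + (θ' - θ)),
        show θ' - (t + (θ' - θ)) = θ - t by ring]
      exact div_le_div_of_nonneg_left (hp _).le (hp _) (strictMono_stdNormalCDF.monotone h)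
    · rw [max_eq_left h0, sub_zero, div_self (hp _).ne']
      refine div_le_one_of_le₀ (strictMono_stdNormalCDF.monotone ?_) (hp _).le
      linarith [le_max_left 0 (t + (θ' - θ))]

/-- The mean of `truncNormal θ b`. -/
def latentMean (θ : ℝ) (b : Bool) : ℝ := sgn b * truncMean (sgn b * θ)

lemma hasDerivAt_latentMean (θ : ℝ) (b : Bool) :
    HasDerivAt (fun θ => latentMean θ b)
      (1 - mills (sgn b * θ) * truncMean (sgn b * θ)) θ := by
  have h := ((hasDerivAt_truncMean (sgn b * θ)).comp θ
    ((hasDerivAt_id θ).const_mul (sgn b))).const_mul (sgn b)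
  refine h.congr_deriv ?_
  cases b <;> simp [sgn]

lemma truncNormal_eq_withDensity (θ : ℝ) (b : Bool) :
    truncNormal θ b = volume.withDensity fun z =>
      ENNReal.ofReal ((halfLine b).indicator (fun z => stdNormalPDF (z - θ)) z /
        stdNormalCDF (sgn b * θ)) := by
  have hne : gaussianReal θ 1 (halfLine b) ≠ ⊤ := measure_ne_top _ _
  rw [truncNormal, ProbabilityTheory.cond, gaussianReal_of_var_ne_zero _ one_ne_zero,
    restrict_withDensity (measurableSet_halfLine b),
    ← withDensity_indicator (measurableSet_halfLine b), ← withDensity_smul _ (by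
      exact (measurable_gaussianPDF _ _).indicator (measurableSet_halfLine b)),
    ← gaussianReal_of_var_ne_zero _ one_ne_zero]
  congr 1
  ext z
  rw [← gaussianReal_real_halfLine, div_eq_inv_mul, ENNReal.ofReal_mul (by positivity),
    measureReal_def, ENNReal.ofReal_inv_of_pos (ENNReal.toReal_pos _ hne),
    ENNReal.ofReal_toReal hne]
  · simp only [Pi.smul_apply, smul_eq_mul]
    congr 1
    by_cases hz : z ∈ halfLine b
    · simp [hz, gaussianPDF, gaussianPDFReal_eq_stdNormalPDF]
    · simp [hz]
  · intro h
    have := gaussianReal_real_halfLine θ b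
    rw [measureReal_def, h] at this
    exact (stdNormalCDF_pos (sgn b * θ)).ne (by simpa using this)

/-- An antiderivative of the first-moment integrand, from which the truncated mean is read off. -/
lemma hasDerivAt_truncMoment (θ z : ℝ) :
    HasDerivAt (fun z => θ * stdNormalCDF (z - θ) - stdNormalPDF (z - θ))
      (stdNormalPDF (z - θ) * z) z := by
  have h := (((hasDerivAt_stdNormalCDF (z - θ)).comp_sub_const z θ).const_mul θ).sub
    ((hasDerivAt_stdNormalPDF (z - θ)).comp_sub_const z θ)
  exact h.congr_deriv (by ring)

lemma integrable_stdNormalPDF_sub_mul (θ : ℝ) :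
    Integrable fun z => stdNormalPDF (z - θ) * z := by
  have h : Integrable id (gaussianReal θ 1) := (memLp_id_gaussianReal 1).integrable le_rfl
  rw [gaussianReal_of_var_ne_zero _ one_ne_zero, integrable_withDensity_iff_integrable_smul'
    (measurable_gaussianPDF _ _) (ae_of_all _ fun _ => gaussianPDF_lt_top)] at h
  refine h.congr (ae_of_all _ fun z => ?_)
  simp [toReal_gaussianPDF, gaussianPDFReal_eq_stdNormalPDF]

lemma integral_truncMoment (θ : ℝ) (b : Bool) :
    ∫ z in halfLine b, stdNormalPDF (z - θ) * z =
      latentMean θ b * stdNormalCDF (sgn b * θ) := by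
  have hcoc {l : Filter ℝ} (hl : l ≤ cocompact ℝ) (hl' : Tendsto (fun z => z - θ) l l) :
      Tendsto (fun z => stdNormalPDF (z - θ)) l (𝓝 0) :=
    (tendsto_stdNormalPDF_cocompact.mono_left hl).comp hl'
  have hp := (stdNormalCDF_pos (sgn b * θ)).ne'
  cases b
  · have ht : Tendsto (fun z => z - θ) atBot atBot :=
      tendsto_atBot_add_const_right atBot (-θ) tendsto_id
    have hlim := ((tendsto_stdNormalCDF_atBot.comp ht).const_mul θ).sub
      (hcoc atBot_le_cocompact ht)
    have h := integral_Iic_of_hasDerivAt_of_tendsto' (a := 0)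
      (fun z _ => hasDerivAt_truncMoment θ z)
      (integrable_stdNormalPDF_sub_mul θ).integrableOn hlim
    rw [halfLine, if_neg (by simp), ← integral_Iic_eq_integral_Iio, h]
    simp only [sgn, latentMean, truncMean, mills, zero_sub, stdNormalPDF_neg, neg_one_mul,
      Bool.false_eq_true, if_false] at hp ⊢
    field_simp
    ring
  · have ht : Tendsto (fun z => z - θ) atTop atTop :=
      tendsto_atTop_add_const_right atTop (-θ) tendsto_id
    have hlim := ((tendsto_stdNormalCDF_atTop.comp ht).const_mul θ).sub
      (hcoc atTop_le_cocompact ht)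
    have h := integral_Ioi_of_hasDerivAt_of_tendsto' (a := 0)
      (fun z _ => hasDerivAt_truncMoment θ z)
      (integrable_stdNormalPDF_sub_mul θ).integrableOn hlim
    rw [halfLine, if_pos rfl, h]
    simp only [sgn, latentMean, truncMean, mills, zero_sub, stdNormalPDF_neg, one_mul,
      if_true, stdNormalCDF_neg] at hp ⊢
    field_simp
    ring

lemma integrable_id_truncNormal (θ : ℝ) (b : Bool) : Integrable id (truncNormal θ b) := by
  have h : Integrable id (gaussianReal θ 1) := (memLp_id_gaussianReal 1).integrable le_rfl
  rw [truncNormal, ProbabilityTheory.cond]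
  refine h.integrableOn.integrable.smul_measure (ENNReal.inv_ne_top.2 fun h0 => ?_)
  have := gaussianReal_real_halfLine θ b
  rw [measureReal_def, h0] at this
  exact (stdNormalCDF_pos (sgn b * θ)).ne (by simpa using this)

lemma integral_id_truncNormal (θ : ℝ) (b : Bool) :
    ∫ z, z ∂truncNormal θ b = latentMean θ b := by
  have hp := (stdNormalCDF_pos (sgn b * θ))
  have hm : Measurable fun z => (halfLine b).indicator (fun z => stdNormalPDF (z - θ)) z :=
    ((continuous_stdNormalPDF.comp (continuous_sub_right θ)).measurable).indicator
      (measurableSet_halfLine b)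
  rw [truncNormal_eq_withDensity, integral_withDensity_eq_integral_toReal_smul
    (hm.div_const _).ennreal_ofReal (by simp)]
  have h0 : ∀ z, (ENNReal.ofReal ((halfLine b).indicator (fun z => stdNormalPDF (z - θ)) z /
        stdNormalCDF (sgn b * θ))).toReal • z =
      (stdNormalCDF (sgn b * θ))⁻¹ *
        (halfLine b).indicator (fun z => stdNormalPDF (z - θ) * z) z := by
    intro z
    rw [ENNReal.toReal_ofReal (div_nonneg (Set.indicator_nonneg
      (fun _ _ => (stdNormalPDF_pos _).le) _) hp.le)]
    by_cases hz : z ∈ halfLine b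
    · simp [hz]; ring
    · simp [hz]
  simp_rw [h0]
  rw [integral_const_mul, integral_indicator (measurableSet_halfLine b), integral_truncMoment]
  field_simp

/-! ### A coupling of the truncated normal distributions -/

/-- A version of `truncNormal θ b` on the unit interval that is monotone and
`1`-Lipschitz in `θ`. -/
def latentQuantile (θ : ℝ) (b : Bool) : ℝ → ℝ := quantile (truncNormal θ b)

lemma measurable_latentQuantile (θ : ℝ) (b : Bool) : Measurable (latentQuantile θ b) :=
  measurable_quantile _

lemma map_latentQuantile (θ : ℝ) (b : Bool) :
    unifUnit.map (latentQuantile θ b) = truncNormal θ b := map_quantile _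

lemma integrable_latentQuantile (θ : ℝ) (b : Bool) :
    Integrable (latentQuantile θ b) unifUnit := by
  have h := integrable_id_truncNormal θ b
  rw [← map_latentQuantile] at h
  exact h.comp_measurable (measurable_latentQuantile θ b)

lemma integral_latentQuantile (θ : ℝ) (b : Bool) :
    ∫ u, latentQuantile θ b u ∂unifUnit = latentMean θ b := by
  rw [← integral_id_truncNormal, ← map_latentQuantile, integral_map
    (measurable_latentQuantile θ b).aemeasurable (by fun_prop)]

/-- For `θ' ≤ θ` the difference of the quantiles lies in `[0, θ - θ']`. The right side is linear in
the quantiles, so its expectation is known from `latentMean`. -/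
lemma sq_latentQuantile_sub_le (θ θ' : ℝ) (b : Bool) (u : ℝ) :
    (latentQuantile θ b u - latentQuantile θ' b u) ^ 2 ≤
      (θ - θ') * (latentQuantile θ b u - latentQuantile θ' b u) := by
  wlog h : θ' ≤ θ generalizing θ θ'
  · have := this θ' θ (le_of_not_ge h)
    linarith
  have h1 : latentQuantile θ' b u ≤ latentQuantile θ b u :=
    quantile_mono (cdf_truncNormal_anti h b) u
  have h2 : latentQuantile θ b u ≤ latentQuantile θ' b u + (θ - θ') :=
    quantile_le_add (sub_nonneg.2 h) (cdf_truncNormal_le_add h b) u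
  nlinarith

/-! ### Densities of product measures and of Gaussian measures -/

lemma map_withDensity_comp {α β : Type*} [MeasurableSpace α] [MeasurableSpace β] (μ : Measure α)
    {T : α → β} (hT : Measurable T) {f : β → ℝ≥0∞} (hf : Measurable f) :
    (μ.withDensity (f ∘ T)).map T = (μ.map T).withDensity f := by
  ext s hs
  rw [Measure.map_apply hT hs, withDensity_apply _ (hT hs), withDensity_apply _ hs,
    setLIntegral_map hs hf hT]
  rfl

lemma pi_withDensity {ι : Type*} [Fintype ι] (μ : ι → Measure ℝ) [∀ i, SigmaFinite (μ i)]
    {g : ι → ℝ → ℝ} (h0 : ∀ i z, 0 ≤ g i z) (hg : ∀ i, Integrable (g i) (μ i)) :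
    Measure.pi (fun i => (μ i).withDensity fun z => ENNReal.ofReal (g i z)) =
      (Measure.pi μ).withDensity fun z => ENNReal.ofReal (∏ i, g i (z i)) := by
  have hfin (i : ι) : IsFiniteMeasure ((μ i).withDensity fun z => ENNReal.ofReal (g i z)) :=
    isFiniteMeasure_withDensity_ofReal (hg i).2
  refine Measure.pi_eq fun s hs => ?_
  have hind (z : ι → ℝ) : (Set.univ.pi s).indicator (fun z => ∏ i, g i (z i)) z =
      ∏ i, (s i).indicator (g i) (z i) := by
    by_cases hz : z ∈ Set.univ.pi s
    · rw [Set.indicator_of_mem hz]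
      exact Finset.prod_congr rfl fun i _ => (Set.indicator_of_mem (hz i (Set.mem_univ i)) _).symm
    · rw [Set.indicator_of_notMem hz]
      simp only [Set.mem_pi, Set.mem_univ, true_imp_iff, not_forall] at hz
      obtain ⟨i, hi⟩ := hz
      exact (Finset.prod_eq_zero (Finset.mem_univ i) (Set.indicator_of_notMem hi _)).symm
  have hS : MeasurableSet (Set.univ.pi s) := MeasurableSet.univ_pi hs
  have hint : Integrable (fun z : ι → ℝ => ∏ i, (s i).indicator (g i) (z i)) (Measure.pi μ) :=
    Integrable.fintype_prod fun i => (hg i).indicator (hs i)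
  have hnn (i : ι) (z : ℝ) : 0 ≤ (s i).indicator (g i) z :=
    Set.indicator_nonneg (fun z _ => h0 i z) z
  calc (Measure.pi μ).withDensity (fun z => ENNReal.ofReal (∏ i, g i (z i))) (Set.univ.pi s)
      = ∫⁻ z, ENNReal.ofReal (∏ i, (s i).indicator (g i) (z i)) ∂Measure.pi μ := by
        rw [withDensity_apply _ hS, ← lintegral_indicator hS]
        refine lintegral_congr fun z => ?_
        rw [← hind]
        by_cases hz : z ∈ Set.univ.pi s <;> simp only [Set.indicator, hz, if_true, if_false,
          ENNReal.ofReal_zero]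
    _ = ENNReal.ofReal (∏ i, ∫ z, (s i).indicator (g i) z ∂μ i) := by
        rw [← ofReal_integral_eq_lintegral_ofReal hint
          (ae_of_all _ fun z => Finset.prod_nonneg fun i _ => hnn i _),
          integral_fintype_prod_eq_prod (fun i => (s i).indicator (g i))]
    _ = ∏ i, (μ i).withDensity (fun z => ENNReal.ofReal (g i z)) (s i) := by
        rw [ENNReal.ofReal_prod_of_nonneg fun i _ => integral_nonneg (hnn i)]
        refine Finset.prod_congr rfl fun i _ => ?_
        rw [withDensity_apply _ (hs i), integral_indicator (hs i),
          ofReal_integral_eq_lintegral_ofReal (hg i).integrableOn (ae_of_all _ (h0 i))]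

lemma stdGaussian_eq_withDensity (p : ℕ) :
    ∃ k : ℝ, 0 < k ∧ stdGaussian (E p) =
      volume.withDensity fun w => ENNReal.ofReal (k * Real.exp (-‖w‖ ^ 2 / 2)) := by
  refine ⟨((√(2 * Real.pi))⁻¹) ^ p, by positivity, ?_⟩
  have hf : Measurable fun w : E p =>
      ENNReal.ofReal (((√(2 * Real.pi))⁻¹) ^ p * Real.exp (-‖w‖ ^ 2 / 2)) := by fun_prop
  have hvol : (volume : Measure (E p)) = (Measure.pi fun _ : Fin p => volume).map (WithLp.toLp 2) :=
    ((PiLp.volume_preserving_toLp (Fin p)).map_eq).symm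
  rw [← map_pi_eq_stdGaussian, hvol, ← map_withDensity_comp _ (by fun_prop) hf]
  congr 1
  rw [gaussianReal_of_var_ne_zero _ one_ne_zero]
  refine (pi_withDensity (fun _ => volume) (g := fun _ => gaussianPDFReal 0 1)
    (fun _ => gaussianPDFReal_nonneg 0 1)
    (fun _ => integrable_gaussianPDFReal 0 1)).trans ?_
  congr 1
  ext z
  simp only [Function.comp_apply]
  congr 1
  have h : ∀ t, gaussianPDFReal 0 1 t = (√(2 * Real.pi))⁻¹ * Real.exp (-t ^ 2 / 2) :=
    stdNormalPDF_eq
  simp_rw [h]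
  rw [Finset.prod_mul_distrib, ← Real.exp_sum, EuclideanSpace.real_norm_sq_eq]
  simp [Finset.sum_div, neg_div]

/-- The quadratic form `bᵀ A b`. -/
def quad {p : ℕ} (A : Matrix (Fin p) (Fin p) ℝ) (b : E p) : ℝ := ⇑b ⬝ᵥ (A *ᵥ ⇑b)

lemma continuous_quad {p : ℕ} (A : Matrix (Fin p) (Fin p) ℝ) : Continuous (quad A) := by
  unfold quad
  fun_prop

lemma quad_eq_inner {p : ℕ} (A : Matrix (Fin p) (Fin p) ℝ) (b : E p) :
    quad A b = inner ℝ b (Matrix.toEuclideanCLM (𝕜 := ℝ) A b) := by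
  rw [Matrix.inner_toEuclideanCLM]
  rfl

open scoped MatrixOrder in
/-- A linear change of variables that standardizes Gaussian measures with covariance `A⁻¹`. -/
lemma exists_standardization {p : ℕ} {A : Matrix (Fin p) (Fin p) ℝ} (hA : A.PosDef) :
    ∃ e : E p ≃L[ℝ] E p,
      (∀ m, multivariateGaussian m A⁻¹ = (stdGaussian (E p)).map fun w => m + e w) ∧
      ∀ w, quad A (e w) = ‖w‖ ^ 2 := by
  -- The symmetric square root `R` of `A⁻¹` maps the standard Gaussian to covariance `A⁻¹`; its
  -- inverse is `R A`.
  set R := CFC.sqrt A⁻¹ with hR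
  have hdet : IsUnit A.det := hA.det_pos.ne'.isUnit
  have hRR : R * R = A⁻¹ := CFC.sqrt_mul_sqrt_self _ hA.inv.posSemidef.nonneg
  have h1 : R * (R * A) = 1 := by
    rw [← mul_assoc, hRR, Matrix.nonsing_inv_mul _ hdet]
  have h2 : R * A * R = 1 := mul_eq_one_comm.1 h1
  set T := Matrix.toEuclideanCLM (n := Fin p) (𝕜 := ℝ) with hT
  have hself : IsSelfAdjoint (T R) := (CFC.sqrt_nonneg A⁻¹).isSelfAdjoint.map _
  refine ⟨ContinuousLinearEquiv.equivOfInverse (T R) (T (R * A)) (fun w => ?_) (fun w => ?_),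
    fun m => rfl, fun w => ?_⟩
  · rw [← mul_apply_eq_comp, ← map_mul, h2]; simp
  · rw [← mul_apply_eq_comp, ← map_mul, h1]; simp
  · rw [quad_eq_inner, ← real_inner_self_eq_norm_sq]
    change inner ℝ (T R w) (T A (T R w)) = _
    rw [← ContinuousLinearMap.adjoint_inner_right, hself.adjoint_eq,
      ← mul_apply_eq_comp, ← mul_apply_eq_comp, ← map_mul, ← map_mul,
      h2]
    simp

/-- Change of variables by the standardizing map. The normalizing constant is left unevaluated,
since it only has to be finite or cancels. -/
lemma withDensity_exp_quad {p : ℕ} {A : Matrix (Fin p) (Fin p) ℝ} (hA : A.PosDef) :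
    ∃ c : ℝ≥0∞, c ≠ 0 ∧ c ≠ ⊤ ∧ ∀ m : E p,
      (volume : Measure (E p)).withDensity
        (fun b => ENNReal.ofReal (Real.exp (-(1 / 2) * quad A (b - m)))) =
        c • multivariateGaussian m A⁻¹ := by
  obtain ⟨e, he, hq⟩ := exists_standardization hA
  obtain ⟨k, hk, hstd⟩ := stdGaussian_eq_withDensity p
  have hdet : LinearMap.det (e : E p →ₗ[ℝ] E p) ≠ 0 :=
    (LinearEquiv.isUnit_det' e.toLinearEquiv).ne_zero
  set d := ENNReal.ofReal |(LinearMap.det (e : E p →ₗ[ℝ] E p))⁻¹| with hd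
  have hd0 : d ≠ 0 := by simpa [hd] using hdet
  have hk0 : ENNReal.ofReal k ≠ 0 := by simpa using hk
  have hvol (m : E p) : (volume : Measure (E p)).map (fun w => m + e w) = d • volume := by
    have h1 : (volume : Measure (E p)).map e = d • volume :=
      Measure.map_linearMap_addHaar_eq_smul_addHaar volume hdet
    have h2 : (fun w => m + e w) = (fun w => m + w) ∘ e := rfl
    rw [h2, ← Measure.map_map (by fun_prop) (by fun_prop), h1, Measure.map_smul,
      map_add_left_eq_self]
  refine ⟨(ENNReal.ofReal k * d)⁻¹, by simp [ENNReal.mul_eq_top, hd], by simp [hd0, hk],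
    fun m => ?_⟩
  have hf : Measurable fun b : E p => ENNReal.ofReal (Real.exp (-(1 / 2) * quad A (b - m))) := by
    have := continuous_quad A
    fun_prop
  have key : multivariateGaussian m A⁻¹ =
      (ENNReal.ofReal k * d) • (volume : Measure (E p)).withDensity
        (fun b => ENNReal.ofReal (Real.exp (-(1 / 2) * quad A (b - m)))) := by
    have hcomp : (fun w : E p => ENNReal.ofReal (k * Real.exp (-‖w‖ ^ 2 / 2))) =
        (fun b => ENNReal.ofReal k * ENNReal.ofReal (Real.exp (-(1 / 2) * quad A (b - m)))) ∘
          fun w => m + e w := by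
      ext w
      simp only [Function.comp_apply, add_sub_cancel_left, hq]
      rw [ENNReal.ofReal_mul hk.le]
      congr 3
      ring
    rw [he, hstd, hcomp, map_withDensity_comp _ (by fun_prop) (hf.const_mul _), hvol,
      withDensity_smul_measure, ← smul_smul, smul_comm]
    congr 1
    exact withDensity_smul _ hf
  rw [key, smul_smul, ENNReal.inv_mul_cancel (mul_ne_zero hk0 hd0)
    (ENNReal.mul_ne_top ENNReal.ofReal_ne_top ENNReal.ofReal_ne_top), one_smul]

/-! ### Smoothness of Gaussian measures under translations -/

/-- The Cameron–Martin formula, obtained by expanding `‖w - a‖²`. -/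
lemma map_add_const_stdGaussian {p : ℕ} (a : E p) :
    (stdGaussian (E p)).map (fun w => w + a) = (stdGaussian (E p)).withDensity fun w =>
      ENNReal.ofReal (Real.exp (inner ℝ w a - ‖a‖ ^ 2 / 2)) := by
  obtain ⟨k, hk, hstd⟩ := stdGaussian_eq_withDensity p
  have hcomp : (fun w : E p => ENNReal.ofReal (k * Real.exp (-‖w‖ ^ 2 / 2))) =
      (fun w => ENNReal.ofReal (k * Real.exp (-‖w - a‖ ^ 2 / 2))) ∘ fun w => w + a := by
    ext w; simp
  conv_lhs => rw [hstd, hcomp, map_withDensity_comp _ (by fun_prop) (by fun_prop),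
    map_add_right_eq_self]
  rw [hstd, ← withDensity_mul _ (by fun_prop) (by fun_prop)]
  congr 1
  ext w
  simp only [Pi.mul_apply]
  rw [← ENNReal.ofReal_mul (by positivity), mul_assoc, ← Real.exp_add, norm_sub_sq_real]
  congr 3
  ring

/-- For short shifts the Cameron–Martin density differs from 1 by at most `‖a‖` times a function
integrable by Fernique's theorem. For `‖a‖ > 1` the difference of probabilities is trivially at most
1. -/
lemma exists_lipschitz_stdGaussian (p : ℕ) :
    ∃ C : ℝ, 0 < C ∧ ∀ (a : E p) (B : Set (E p)), MeasurableSet B →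
      |(stdGaussian (E p)).real ((fun w => w + a) ⁻¹' B) - (stdGaussian (E p)).real B| ≤
        C * ‖a‖ := by
  set γ := stdGaussian (E p) with hγ
  have hint : Integrable (fun w : E p => (‖w‖ + 1) * Real.exp (‖w‖ + 1)) γ := by
    obtain ⟨c, hc, hci⟩ := IsGaussian.exists_integrable_exp_sq γ
    refine (hci.const_mul (Real.exp (1 / c + 2))).mono' (by fun_prop) (ae_of_all _ fun w => ?_)
    rw [Real.norm_of_nonneg (by positivity), ← Real.exp_add]
    have h1 : ‖w‖ + 1 ≤ Real.exp (‖w‖ + 1) := by linarith [Real.add_one_le_exp (‖w‖ + 1)]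
    calc (‖w‖ + 1) * Real.exp (‖w‖ + 1) ≤ Real.exp (‖w‖ + 1) * Real.exp (‖w‖ + 1) := by gcongr
      _ = Real.exp (2 * ‖w‖ + 2) := by rw [← Real.exp_add]; ring_nf
      _ ≤ _ := by
        refine Real.exp_le_exp.2 ?_
        have : c * (‖w‖ - 1 / c) ^ 2 = c * ‖w‖ ^ 2 - 2 * ‖w‖ + 1 / c := by field_simp; ring
        nlinarith [mul_nonneg hc.le (sq_nonneg (‖w‖ - 1 / c))]
  set I := ∫ w, (‖w‖ + 1) * Real.exp (‖w‖ + 1) ∂γ with hI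
  have hI0 : 0 ≤ I := integral_nonneg fun w => by positivity
  -- `I` serves short shifts, the added 1 long ones.
  refine ⟨I + 1, by positivity, fun a B hB => ?_⟩
  rcases le_or_gt ‖a‖ 1 with ha | ha
  · set f : E p → ℝ := fun w => Real.exp (inner ℝ w a - ‖a‖ ^ 2 / 2) with hf
    have hfm : Measurable f := by fun_prop
    have hmap := map_add_const_stdGaussian a
    have hfl : ∫⁻ w, ENNReal.ofReal (f w) ∂γ = 1 := by
      have := congrArg (fun m => m Set.univ) hmap
      simp only [withDensity_apply _ MeasurableSet.univ, Measure.restrict_univ] at this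
      rw [← this, Measure.map_apply (by fun_prop) MeasurableSet.univ]
      simp
    have hfi : Integrable f γ := by
      refine ⟨hfm.aestronglyMeasurable, ?_⟩
      rw [hasFiniteIntegral_iff_ofReal (ae_of_all _ fun w => (Real.exp_pos _).le), hfl]
      exact ENNReal.one_lt_top
    have h1 : γ.real ((fun w => w + a) ⁻¹' B) = ∫ w in B, f w ∂γ := by
      rw [measureReal_def, ← Measure.map_apply (by fun_prop) hB, hmap, withDensity_apply _ hB,
        integral_eq_lintegral_of_nonneg_ae (ae_of_all _ fun w => (Real.exp_pos _).le)
          hfm.aestronglyMeasurable]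
    have h2 : γ.real B = ∫ w in B, (1 : ℝ) ∂γ := by simp
    rw [h1, h2, ← integral_sub hfi.integrableOn (integrable_const _)]
    have hb (w : E p) : |f w - 1| ≤ ‖a‖ * ((‖w‖ + 1) * Real.exp (‖w‖ + 1)) := by
      set t := inner ℝ w a - ‖a‖ ^ 2 / 2 with ht
      have hin : |(inner ℝ w a : ℝ)| ≤ ‖w‖ * ‖a‖ := abs_real_inner_le_norm w a
      have htb : |t| ≤ ‖a‖ * (‖w‖ + 1) := by
        rw [abs_le] at hin ⊢
        constructor <;> nlinarith [norm_nonneg a, norm_nonneg w]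
      have htb2 : |t| ≤ ‖w‖ + 1 := htb.trans (mul_le_of_le_one_left (by positivity) ha)
      have he : |Real.exp t - 1| ≤ |t| * Real.exp |t| := by
        rcases le_total 0 t with h0 | h0
        · rw [abs_of_nonneg h0, abs_of_nonneg (by linarith [Real.one_le_exp h0])]
          have h3 := Real.add_one_le_exp (-t)
          have h4 : Real.exp (-t) * Real.exp t = 1 := by rw [← Real.exp_add]; simp
          nlinarith [Real.exp_pos t]
        · rw [abs_of_nonpos h0, abs_of_nonpos (by linarith [Real.exp_le_one_iff.2 h0])]
          have h3 := Real.add_one_le_exp t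
          nlinarith [Real.one_le_exp (neg_nonneg.2 h0)]
      calc |f w - 1| ≤ |t| * Real.exp |t| := he
        _ ≤ (‖a‖ * (‖w‖ + 1)) * Real.exp (‖w‖ + 1) := by gcongr
        _ = _ := by ring
    calc |∫ w in B, (f w - 1) ∂γ| ≤ ∫ w in B, |f w - 1| ∂γ := abs_integral_le_integral_abs
      _ ≤ ∫ w, |f w - 1| ∂γ := setIntegral_le_integral (hfi.sub (integrable_const 1)).abs
          (ae_of_all _ fun w => abs_nonneg _)
      _ ≤ ∫ w, ‖a‖ * ((‖w‖ + 1) * Real.exp (‖w‖ + 1)) ∂γ :=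
          integral_mono (hfi.sub (integrable_const 1)).abs (hint.const_mul _) hb
      _ = ‖a‖ * I := integral_const_mul _ _
      _ ≤ (I + 1) * ‖a‖ := by nlinarith [norm_nonneg a]
  · have h1 := measureReal_nonneg (μ := γ) (s := (fun w => w + a) ⁻¹' B)
    have h2 := measureReal_nonneg (μ := γ) (s := B)
    have h3 := measureReal_le_one (μ := γ) (s := (fun w => w + a) ⁻¹' B)
    have h4 := measureReal_le_one (μ := γ) (s := B)
    have : |γ.real ((fun w => w + a) ⁻¹' B) - γ.real B| ≤ 1 := abs_le.2 ⟨by linarith, by linarith⟩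
    nlinarith

/-- In standardized coordinates the change of mean is a shift of length `√(quad A (m - m'))`. -/
lemma exists_lipschitz_multivariateGaussian {p : ℕ} {A : Matrix (Fin p) (Fin p) ℝ}
    (hA : A.PosDef) :
    ∃ C : ℝ, 0 < C ∧ ∀ (m m' : E p) (B : Set (E p)), MeasurableSet B →
      |(multivariateGaussian m A⁻¹).real B - (multivariateGaussian m' A⁻¹).real B| ≤
        C * √(quad A (m - m')) := by
  obtain ⟨e, he, hq⟩ := exists_standardization hA
  obtain ⟨C, hC, h⟩ := exists_lipschitz_stdGaussian p
  refine ⟨C, hC, fun m m' B hB => ?_⟩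
  have h1 := h (e.symm (m - m')) ((fun w => m' + e w) ⁻¹' B) (hB.preimage (by fun_prop))
  have h2 : quad A (m - m') = ‖e.symm (m - m')‖ ^ 2 := by rw [← hq]; simp
  rw [h2, Real.sqrt_sq (norm_nonneg _), he, he, map_measureReal_apply (by fun_prop) hB,
    map_measureReal_apply (by fun_prop) hB]
  convert h1 using 4
  ext w
  have : m' + (e w + (m - m')) = m + e w := by abel
  simp [this]

/-! ### The precision matrix -/

section Precision

variable {p n : ℕ} {Q : Matrix (Fin p) (Fin p) ℝ} {x : Fin n → E p}

lemma designMatrix_mulVec (x : Fin n → E p) (b : E p) :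
    designMatrix x *ᵥ ⇑b = fun i => inner ℝ (x i) b := by
  ext i
  simp [designMatrix, Matrix.mulVec, dotProduct, PiLp.inner_apply, mul_comm]

lemma dotProduct_designMatrix_transpose_mulVec (x : Fin n → E p) (b : E p) (w : Fin n → ℝ) :
    ⇑b ⬝ᵥ ((designMatrix x)ᵀ *ᵥ w) = ∑ i, inner ℝ (x i) b * w i := by
  rw [Matrix.dotProduct_mulVec, Matrix.vecMul_transpose, designMatrix_mulVec]
  rfl

lemma quad_precision (Q : Matrix (Fin p) (Fin p) ℝ) (x : Fin n → E p) (b : E p) :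
    quad (precision Q x) b = ∑ i, inner ℝ (x i) b ^ 2 + quad Q b := by
  rw [quad, precision, Matrix.add_mulVec, dotProduct_add, ← Matrix.mulVec_mulVec,
    dotProduct_designMatrix_transpose_mulVec, designMatrix_mulVec]
  simp [quad, sq]

lemma quad_nonneg {A : Matrix (Fin p) (Fin p) ℝ} (hA : A.PosSemidef) (b : E p) : 0 ≤ quad A b := by
  simpa [quad] using hA.dotProduct_mulVec_nonneg ⇑b

lemma quad_pos {A : Matrix (Fin p) (Fin p) ℝ} (hA : A.PosDef) {b : E p} (hb : b ≠ 0) :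
    0 < quad A b := by
  have h : (⇑b : Fin p → ℝ) ≠ 0 := fun h => hb (by ext i; exact congrFun h i)
  simpa [quad] using hA.dotProduct_mulVec_pos h

lemma isHermitian_precision (hQ : Q.PosSemidef) (x : Fin n → E p) :
    (precision Q x).IsHermitian := by
  have h : ((designMatrix x)ᵀ * designMatrix x).IsHermitian := by
    simpa using Matrix.isHermitian_conjTranspose_mul_self (designMatrix x)
  exact h.add hQ.1

/-- The map `z ↦ Σ⁻¹ (Xᵀ z + Q v)` does not increase distances, if `ℝ^p` is equipped with the
norm of the quadratic form of `Σ`. -/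
lemma quad_coefMean_sub_le (hQ : Q.PosSemidef) (hS : (precision Q x).PosDef) (v : E p)
    (z z' : Fin n → ℝ) :
    quad (precision Q x) (coefMean Q v x z - coefMean Q v x z') ≤ ∑ i, (z i - z' i) ^ 2 := by
  set u := coefMean Q v x z - coefMean Q v x z' with hu
  have hdet : IsUnit (precision Q x).det := hS.det_pos.ne'.isUnit
  have hu' : precision Q x *ᵥ ⇑u = (designMatrix x)ᵀ *ᵥ (z - z') := by
    have h : (⇑u : Fin p → ℝ) = (precision Q x)⁻¹ *ᵥ ((designMatrix x)ᵀ *ᵥ (z - z')) := by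
      simp only [hu, coefMean, ← WithLp.toLp_sub, ← Matrix.mulVec_sub,
        add_sub_add_right_eq_sub]
    rw [h, Matrix.mulVec_mulVec, Matrix.mul_nonsing_inv _ hdet, Matrix.one_mulVec]
  have h1 : quad (precision Q x) u = ∑ i, inner ℝ (x i) u * (z i - z' i) := by
    rw [quad, hu', dotProduct_designMatrix_transpose_mulVec]
    rfl
  have h2 := quad_precision Q x u
  have h3 := quad_nonneg hQ u
  -- By AM-GM; the term `½ ∑ ⟨x_i, u⟩²` is then absorbed in `quad (precision Q x) u`.
  have h4 : ∑ i, inner ℝ (x i) u * (z i - z' i) ≤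
      ∑ i, (1 / 2 * inner ℝ (x i) u ^ 2 + 1 / 2 * (z i - z' i) ^ 2) :=
    Finset.sum_le_sum fun i _ => by nlinarith [sq_nonneg (inner ℝ (x i) u - (z i - z' i))]
  rw [Finset.sum_add_distrib, ← Finset.mul_sum, ← Finset.mul_sum] at h4
  linarith

end Precision

/-! ### Discordant observations -/

section Discordant

variable {p n : ℕ}

/-- The observations `(x, y)` for which `x` or `-x` lies in the orthant `j` and the response `y` is
discordant with the sign of `xᵀβ` for the parameters `β` in the orthant `j`. -/
def discordant (j : Fin p → Bool) : Set (E p × Bool) :=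
  {d | (d.2 = false ∧ d.1 ∈ orthant j) ∨ (d.2 = true ∧ -d.1 ∈ orthant j)}

/-- The contribution of an observation to the quadratic form of the discordant observations. -/
def discordantSq (j : Fin p → Bool) (b : E p) (d : E p × Bool) : ℝ :=
  (discordant j).indicator (fun d => inner ℝ d.1 b ^ 2) d

lemma inner_nonneg_of_mem_orthant {j : Fin p → Bool} {x β : E p} (hx : x ∈ orthant j)
    (hβ : ∀ k, j k = true ↔ 0 ≤ β k) : 0 ≤ inner ℝ x β := by
  rw [PiLp.inner_apply]
  refine Finset.sum_nonneg fun k _ => ?_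
  have h := hx k
  simp only [RCLike.inner_apply, conj_trivial]
  by_cases hk : j k = true
  · rw [if_pos hk] at h
    exact mul_nonneg ((hβ k).1 hk) h.le
  · rw [if_neg hk] at h
    exact mul_nonneg_of_nonpos_of_nonpos (le_of_not_ge fun h => hk ((hβ k).2 h)) h.le

/-- Take the sign pattern of `β`, counting zero as positive. Finitely many orthants thus control all
`β`, which is what makes the bounds uniform. -/
lemma exists_orthant_discordant (β : E p) :
    ∃ j : Fin p → Bool, ∀ d ∈ discordant j, sgn d.2 * inner ℝ d.1 β ≤ 0 := by
  classical
  refine ⟨fun k => decide (0 ≤ β k), ?_⟩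
  rintro ⟨x, y⟩ (⟨h1, h2⟩ | ⟨h1, h2⟩) <;> dsimp only at h1 h2 ⊢ <;>
    have h := inner_nonneg_of_mem_orthant h2 (β := β) (by simp)
  · simp [h1, sgn, h]
  · simpa [h1, sgn] using h

variable {Q : Matrix (Fin p) (Fin p) ℝ} {x : Fin n → E p} {y : Fin n → Bool} {c : ℝ}

/-- The mean of the latent vector, projected to the coefficients, is a contraction. -/
lemma sum_inner_mul_latentMean_sub_le (hQ : Q.PosSemidef)
    (hd : ∀ j b, c * quad (precision Q x) b ≤ ∑ i, discordantSq j b (x i, y i)) (β β' : E p) :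
    ∑ i, inner ℝ (x i) (β - β') *
        (latentMean (inner ℝ (x i) β) (y i) - latentMean (inner ℝ (x i) β') (y i)) ≤
      (1 - c / 2) * quad (precision Q x) (β - β') := by
  set α := β - β' with hα
  -- The mean value theorem along the segment from `β'` to `β`; `τ` is one minus the truncated
  -- variance.
  set f : ℝ → ℝ := fun t => ∑ i, inner ℝ (x i) α * latentMean (inner ℝ (x i) (β' + t • α)) (y i)
    with hf
  set τ : E p → Fin n → ℝ := fun b i =>
    mills (sgn (y i) * inner ℝ (x i) b) * truncMean (sgn (y i) * inner ℝ (x i) b) with hτ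
  have hder (t : ℝ) : HasDerivAt f
      (∑ i, inner ℝ (x i) α * ((1 - τ (β' + t • α) i) * inner ℝ (x i) α)) t := by
    refine HasDerivAt.fun_sum fun i _ => HasDerivAt.const_mul _ ?_
    have h1 : HasDerivAt (fun t : ℝ => (inner ℝ (x i) (β' + t • α) : ℝ)) (inner ℝ (x i) α) t := by
      simp only [inner_add_right, real_inner_smul_right]
      simpa using ((hasDerivAt_id t).mul_const (inner ℝ (x i) α)).const_add (inner ℝ (x i) β')
    exact HasDerivAt.comp (h₂ := fun θ => latentMean θ (y i)) t
      (hasDerivAt_latentMean (inner ℝ (x i) (β' + t • α)) (y i)) h1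
  obtain ⟨t, -, ht⟩ := exists_hasDerivAt_eq_slope f _ zero_lt_one
    (fun t _ => (hder t).continuousAt.continuousWithinAt) (fun t _ => hder t)
  have hdiff : f 1 - f 0 = ∑ i, inner ℝ (x i) α *
        (latentMean (inner ℝ (x i) β) (y i) - latentMean (inner ℝ (x i) β') (y i)) := by
    simp [hf, hα, ← Finset.sum_sub_distrib, mul_sub]
  rw [← hdiff]
  rw [sub_zero, div_one] at ht
  rw [← ht]
  -- The orthant is that of an unknown intermediate point, so `hd` must hold for every `j`.
  obtain ⟨j, hj⟩ := exists_orthant_discordant (β' + t • α)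
  have hterm (i : Fin n) : inner ℝ (x i) α * ((1 - τ (β' + t • α) i) * inner ℝ (x i) α) ≤
      inner ℝ (x i) α ^ 2 - 1 / 2 * discordantSq j α (x i, y i) := by
    by_cases h : (x i, y i) ∈ discordant j
    · have h2 := half_le_mills_mul_truncMean (hj _ h)
      have h3 : (1 : ℝ) / 2 ≤ τ (β' + t • α) i := h2
      rw [discordantSq, Set.indicator_of_mem h]
      nlinarith [sq_nonneg (inner ℝ (x i) α)]
    · have h3 : 0 ≤ τ (β' + t • α) i := (mul_pos (mills_pos _) (truncMean_pos _)).le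
      rw [discordantSq, Set.indicator_of_notMem h]
      nlinarith [sq_nonneg (inner ℝ (x i) α)]
  refine (Finset.sum_le_sum fun i _ => hterm i).trans ?_
  rw [Finset.sum_sub_distrib, ← Finset.mul_sum]
  have h1 := quad_precision Q x α
  have h2 := quad_nonneg hQ α
  have h3 := hd j α
  linarith

end Discordant

/-! ### Contraction properties of the chain -/

section Chain

variable {p n : ℕ} {Q : Matrix (Fin p) (Fin p) ℝ} {v : E p} {x : Fin n → E p} {y : Fin n → Bool}

instance : IsMarkovKernel (latentKernel x y) :=
  ⟨fun β => by
    change IsProbabilityMeasure (Measure.pi fun i => truncNormal (inner ℝ (x i) β) (y i))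
    infer_instance⟩

instance : IsMarkovKernel (coefKernel Q v x) :=
  ⟨fun z => by
    change IsProbabilityMeasure (multivariateGaussian (coefMean Q v x z) (precision Q x)⁻¹)
    infer_instance⟩

instance : IsMarkovKernel (chain Q v x y) := by
  unfold chain
  infer_instance

instance isMarkovKernel_pow {S : Type*} [MeasurableSpace S] (κ : Kernel S S) [IsMarkovKernel κ]
    (m : ℕ) : IsMarkovKernel (κ ^ m) := by
  induction m with
  | zero => exact inferInstanceAs (IsMarkovKernel Kernel.id)
  | succ m ih =>
    rw [pow_succ]
    exact inferInstanceAs (IsMarkovKernel ((κ ^ m) ∘ₖ κ))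

lemma continuous_coefMean (Q : Matrix (Fin p) (Fin p) ℝ) (v : E p) (x : Fin n → E p) :
    Continuous (coefMean Q v x) := by
  unfold coefMean
  fun_prop

/-- The latent vector as a function of independent uniform variables. -/
def latentOfUnif (x : Fin n → E p) (y : Fin n → Bool) (β : E p) (u : Fin n → ℝ) : Fin n → ℝ :=
  fun i => latentQuantile (inner ℝ (x i) β) (y i) (u i)

lemma measurable_latentOfUnif (β : E p) : Measurable (latentOfUnif x y β) :=
  measurable_pi_lambda _ fun i => (measurable_latentQuantile _ _).comp (measurable_pi_apply i)

lemma latentKernel_eq_map (β : E p) :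
    latentKernel x y β = (Measure.pi fun _ : Fin n => unifUnit).map (latentOfUnif x y β) := by
  have hs (i : Fin n) : IsProbabilityMeasure
      (unifUnit.map (latentQuantile (inner ℝ (x i) β) (y i))) := by
    rw [map_latentQuantile]; infer_instance
  have h := Measure.pi_map_pi (μ := fun _ : Fin n => unifUnit)
    (f := fun i => latentQuantile (inner ℝ (x i) β) (y i))
    fun i => (measurable_latentQuantile _ _).aemeasurable
  simp_rw [map_latentQuantile] at h
  exact h.symm

/-- The contraction in dual form: a latent draw followed by projection multiplies Lipschitz
constants by `√(1 - c/2)`. Both integrals are written over the same uniform variables. -/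
lemma abs_integral_coefMean_sub_le {c : ℝ} (hc : c < 2) (hQ : Q.PosSemidef)
    (hS : (precision Q x).PosDef)
    (hd : ∀ j b, c * quad (precision Q x) b ≤ ∑ i, discordantSq j b (x i, y i))
    {g : E p → ℝ} (hg : Measurable g) (hg0 : ∀ m, 0 ≤ g m) (hg1 : ∀ m, g m ≤ 1) {L : ℝ}
    (hL : 0 ≤ L) (hgL : ∀ m m', |g m - g m'| ≤ L * √(quad (precision Q x) (m - m')))
    (β β' : E p) :
    |∫ z, g (coefMean Q v x z) ∂latentKernel x y β -
        ∫ z, g (coefMean Q v x z) ∂latentKernel x y β'| ≤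
      L * √(1 - c / 2) * √(quad (precision Q x) (β - β')) := by
  -- Equal starting points are separated because `s` becomes a divisor.
  rcases eq_or_ne β β' with rfl | hne
  · simp [quad]
  set U := Measure.pi fun _ : Fin n => unifUnit with hU
  set s := √(1 - c / 2) * √(quad (precision Q x) (β - β')) with hs
  have hs0 : 0 < s := mul_pos (Real.sqrt_pos.2 (by linarith))
    (Real.sqrt_pos.2 (quad_pos hS (sub_ne_zero.2 hne)))
  have hs2 : s ^ 2 = (1 - c / 2) * quad (precision Q x) (β - β') := by
    rw [hs, mul_pow, Real.sq_sqrt (by linarith), Real.sq_sqrt (quad_nonneg hS.posSemidef _)]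
  have hgm : Measurable fun z => g (coefMean Q v x z) :=
    hg.comp (continuous_coefMean Q v x).measurable
  have hmap (b : E p) : ∫ z, g (coefMean Q v x z) ∂latentKernel x y b =
      ∫ u, g (coefMean Q v x (latentOfUnif x y b u)) ∂U := by
    rw [latentKernel_eq_map, integral_map (measurable_latentOfUnif b).aemeasurable
      hgm.aestronglyMeasurable]
  have hint (b : E p) : Integrable (fun u => g (coefMean Q v x (latentOfUnif x y b u))) U :=
    Integrable.of_bound (hgm.comp (measurable_latentOfUnif b)).aestronglyMeasurable 1
      (ae_of_all _ fun u => by rw [Real.norm_of_nonneg (hg0 _)]; exact hg1 _)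
  set W : (Fin n → ℝ) → ℝ := fun u => ∑ i, inner ℝ (x i) (β - β') *
    (latentOfUnif x y β u i - latentOfUnif x y β' u i) with hW
  have hiq (b : E p) (i : Fin n) : Integrable (fun u => latentOfUnif x y b u i) U :=
    integrable_comp_eval (μ := fun _ : Fin n => unifUnit) (i := i)
      (integrable_latentQuantile (inner ℝ (x i) b) (y i))
  have hmq (b : E p) (i : Fin n) :
      ∫ u, latentOfUnif x y b u i ∂U = latentMean (inner ℝ (x i) b) (y i) := by
    rw [← integral_latentQuantile]
    exact integral_comp_eval (μ := fun _ : Fin n => unifUnit) (i := i)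
      (measurable_latentQuantile (inner ℝ (x i) b) (y i)).aestronglyMeasurable
  have hWi : Integrable W U :=
    integrable_finsetSum _ fun i _ => ((hiq β i).sub (hiq β' i)).const_mul _
  have hWle : ∫ u, W u ∂U ≤ s ^ 2 := by
    rw [hs2]
    refine le_trans (le_of_eq ((integral_finsetSum _ fun i _ =>
      ((hiq β i).sub (hiq β' i)).const_mul _).trans (Finset.sum_congr rfl fun i _ => ?_)))
      (sum_inner_mul_latentMean_sub_le hQ hd β β')
    simp only [Pi.sub_apply]
    rw [integral_const_mul, integral_sub (hiq β i) (hiq β' i), hmq, hmq]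
  -- `√W ≤ (W/s + s)/2` bounds the distance by an affine function of `W`; as `W` has mean at most
  -- `s²`, this function has mean at most `s`.
  have hpt (u : Fin n → ℝ) : |g (coefMean Q v x (latentOfUnif x y β u)) -
      g (coefMean Q v x (latentOfUnif x y β' u))| ≤ L * ((W u / s + s) / 2) := by
    refine (hgL _ _).trans (mul_le_mul_of_nonneg_left ?_ hL)
    have h1 := quad_coefMean_sub_le hQ hS v (latentOfUnif x y β u) (latentOfUnif x y β' u)
    have h2 : ∑ i, (latentOfUnif x y β u i - latentOfUnif x y β' u i) ^ 2 ≤ W u := by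
      refine Finset.sum_le_sum fun i _ => ?_
      rw [inner_sub_right]
      exact sq_latentQuantile_sub_le _ _ _ _
    have h3 := Real.sqrt_le_sqrt (h1.trans h2)
    have h4 : 0 ≤ W u := (Finset.sum_nonneg fun i _ => sq_nonneg _).trans h2
    refine h3.trans ?_
    have h5 : W u / s = √(W u) ^ 2 / s := by rw [Real.sq_sqrt h4]
    rw [h5, le_div_iff₀ two_pos, div_add' _ _ _ hs0.ne', le_div_iff₀ hs0]
    nlinarith [sq_nonneg (√(W u) - s)]
  rw [hmap, hmap, ← integral_sub (hint β) (hint β')]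
  have hri : Integrable (fun u => L * ((W u / s + s) / 2)) U :=
    (((hWi.div_const s).add (integrable_const s)).div_const 2).const_mul L
  calc |∫ u, (g (coefMean Q v x (latentOfUnif x y β u)) -
        g (coefMean Q v x (latentOfUnif x y β' u))) ∂U|
      ≤ ∫ u, |g (coefMean Q v x (latentOfUnif x y β u)) -
        g (coefMean Q v x (latentOfUnif x y β' u))| ∂U := abs_integral_le_integral_abs
    _ ≤ ∫ u, L * ((W u / s + s) / 2) ∂U :=
        integral_mono ((hint β).sub (hint β')).abs hri hpt
    _ = L * (((∫ u, W u ∂U) / s + s) / 2) := by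
        rw [integral_const_mul, integral_div, integral_add (hWi.div_const s) (integrable_const s),
          integral_div]
        simp
    _ ≤ L * ((s ^ 2 / s + s) / 2) := by gcongr
    _ = L * √(1 - c / 2) * √(quad (precision Q x) (β - β')) := by
        rw [mul_assoc, ← hs]
        field_simp
        ring

lemma chain_pow_succ_real (m : ℕ) (β : E p) {A : Set (E p)} (hA : MeasurableSet A) :
    ((chain Q v x y ^ (m + 1)) β).real A =
      ∫ z, ∫ b, ((chain Q v x y ^ m) b).real A ∂coefKernel Q v x z ∂latentKernel x y β := by
  have hmeas : Measurable fun b => ((chain Q v x y ^ m) b).real A :=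
    ((chain Q v x y ^ m).measurable_coe hA).ennreal_toReal
  rw [← Kernel.integral_comp]
  · rw [measureReal_def, add_comm, Kernel.pow_add_apply_eq_lintegral _ 1 m β hA, pow_one]
    simp_rw [measureReal_def]
    rw [integral_toReal ((chain Q v x y ^ m).measurable_coe hA).aemeasurable
      (ae_of_all _ fun b => measure_lt_top _ _)]
    rfl
  · refine Integrable.of_bound hmeas.aestronglyMeasurable 1 (ae_of_all _ fun b => ?_)
    rw [Real.norm_of_nonneg measureReal_nonneg]
    exact measureReal_le_one

/-- The Gaussian draw of the last step makes the indicator of `A` Lipschitz; going backwards, every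
latent draw contributes a factor `√(1 - c/2)`, and the remaining Gaussian draws cost nothing. -/
lemma abs_chain_pow_real_sub_le {c : ℝ} (hc : c < 2) (hQ : Q.PosSemidef)
    (hS : (precision Q x).PosDef)
    (hd : ∀ j b, c * quad (precision Q x) b ≤ ∑ i, discordantSq j b (x i, y i)) :
    ∃ C : ℝ, 0 < C ∧ ∀ (m : ℕ) (β β' : E p) (A : Set (E p)), MeasurableSet A →
      |((chain Q v x y ^ (m + 1)) β).real A - ((chain Q v x y ^ (m + 1)) β').real A| ≤
        C * √(1 - c / 2) ^ (m + 1) * √(quad (precision Q x) (β - β')) := by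
  obtain ⟨C, hC, hlip⟩ := exists_lipschitz_multivariateGaussian hS
  obtain ⟨e, he, hq⟩ := exists_standardization hS
  refine ⟨C, hC, fun m β β' A hA => ?_⟩
  have hmeas (m : ℕ) : Measurable fun b => ((chain Q v x y ^ m) b).real A :=
    ((chain Q v x y ^ m).measurable_coe hA).ennreal_toReal
  -- The probability of ending in `A` after a Gaussian draw with mean `m` and `k` further steps. The
  -- mean enters only as a translation, so two means can share the noise `w`.
  set g : ℕ → E p → ℝ := fun k m =>
    ∫ w, ((chain Q v x y ^ k) (m + e w)).real A ∂stdGaussian (E p) with hg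
  have hgi (k : ℕ) (m : E p) :
      Integrable (fun w => ((chain Q v x y ^ k) (m + e w)).real A) (stdGaussian (E p)) := by
    refine Integrable.of_bound ((hmeas k).comp (by fun_prop)).aestronglyMeasurable 1
      (ae_of_all _ fun w => ?_)
    rw [Real.norm_of_nonneg measureReal_nonneg]
    exact measureReal_le_one
  have hgm (k : ℕ) : Measurable (g k) :=
    (StronglyMeasurable.integral_prod_right (f := fun m w =>
      ((chain Q v x y ^ k) (m + e w)).real A)
      ((hmeas k).comp (by fun_prop : Measurable fun q : E p × E p =>
        q.1 + e q.2)).stronglyMeasurable).measurable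
  have hg0 (k : ℕ) (m : E p) : 0 ≤ g k m := integral_nonneg fun w => measureReal_nonneg
  have hg1 (k : ℕ) (m : E p) : g k m ≤ 1 := by
    refine (integral_mono (hgi k m) (integrable_const 1) fun w => measureReal_le_one).trans ?_
    simp
  have hgeq (k : ℕ) (z : Fin n → ℝ) :
      ∫ b, ((chain Q v x y ^ k) b).real A ∂coefKernel Q v x z = g k (coefMean Q v x z) := by
    change ∫ b, ((chain Q v x y ^ k) b).real A
      ∂multivariateGaussian (coefMean Q v x z) (precision Q x)⁻¹ = _
    rw [he, integral_map (by fun_prop) (hmeas k).aestronglyMeasurable]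
  induction m generalizing β β' with
  | zero =>
    simp_rw [chain_pow_succ_real _ _ hA, hgeq]
    have hL (m m' : E p) : |g 0 m - g 0 m'| ≤ C * √(quad (precision Q x) (m - m')) := by
      have h (m : E p) : g 0 m = (multivariateGaussian m (precision Q x)⁻¹).real A := by
        rw [hg, he, map_measureReal_apply (by fun_prop) hA,
          ← integral_indicator_one (hA.preimage (by fun_prop))]
        refine integral_congr_ae (ae_of_all _ fun w => ?_)
        change ((chain Q v x y ^ 0) (m + e w)).real A = _
        rw [pow_zero]
        change (Measure.dirac (m + e w)).real A = _
        rw [measureReal_def, Measure.dirac_apply' _ hA]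
        by_cases hw : m + e w ∈ A <;> simp [hw]
      rw [h, h]
      exact hlip m m' A hA
    simpa using abs_integral_coefMean_sub_le hc hQ hS hd (hgm 0) (hg0 0) (hg1 0) hC.le hL β β'
  | succ k ih =>
    simp_rw [chain_pow_succ_real (k + 1) _ hA, hgeq]
    -- Averaging over common noise preserves the Lipschitz constant.
    have hL (m m' : E p) : |g (k + 1) m - g (k + 1) m'| ≤
        C * √(1 - c / 2) ^ (k + 1) * √(quad (precision Q x) (m - m')) := by
      rw [hg, ← integral_sub (hgi _ _) (hgi _ _)]
      refine abs_integral_le_integral_abs.trans ?_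
      refine (integral_mono ((hgi _ _).sub (hgi _ _)).abs (integrable_const
        (C * √(1 - c / 2) ^ (k + 1) * √(quad (precision Q x) (m - m')))) fun w => ?_).trans ?_
      · simpa using ih (m + e w) (m' + e w)
      · simp
    have := abs_integral_coefMean_sub_le (v := v) hc hQ hS hd (hgm (k + 1)) (hg0 (k + 1))
      (hg1 (k + 1))
      (by positivity) hL β β'
    rw [pow_succ]
    linarith

end Chain

/-! ### The posterior distribution -/

section Posterior

variable {p n : ℕ} {Q : Matrix (Fin p) (Fin p) ℝ} {v : E p} {x : Fin n → E p} {y : Fin n → Bool}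

lemma posteriorWeight_eq (Q : Matrix (Fin p) (Fin p) ℝ) (v : E p) (x : Fin n → E p)
    (y : Fin n → Bool) (β : E p) :
    posteriorWeight Q v x y β = (∏ i, stdNormalCDF (sgn (y i) * inner ℝ (x i) β)) *
      Real.exp (-(1 / 2) * quad Q (β - v)) := by
  rw [posteriorWeight, quad]
  congr 1
  refine Finset.prod_congr rfl fun i _ => ?_
  cases y i <;> simp [sgn, stdNormalCDF_neg]

lemma posteriorWeight_pos (β : E p) : 0 < posteriorWeight Q v x y β := by
  rw [posteriorWeight_eq]
  exact mul_pos (Finset.prod_pos fun i _ => stdNormalCDF_pos _) (Real.exp_pos _)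

lemma measurable_posteriorWeight : Measurable (posteriorWeight Q v x y) := by
  have h1 := continuous_quad Q
  have h2 := continuous_stdNormalCDF
  rw [funext (posteriorWeight_eq Q v x y)]
  fun_prop

/-- Likelihood factors of observations discordant with `β` decay like Gaussians; all other factors,
and the prior, are at most 1. -/
lemma posteriorWeight_le {c : ℝ} (hQ : Q.PosSemidef)
    (hd : ∀ j b, c * quad (precision Q x) b ≤ ∑ i, discordantSq j b (x i, y i)) (β : E p) :
    posteriorWeight Q v x y β ≤ Real.exp (-(1 / 2) * (c * quad (precision Q x) β)) := by
  obtain ⟨j, hj⟩ := exists_orthant_discordant β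
  have hterm (i : Fin n) : stdNormalCDF (sgn (y i) * inner ℝ (x i) β) ≤
      Real.exp (-(1 / 2) * discordantSq j β (x i, y i)) := by
    by_cases h : (x i, y i) ∈ discordant j
    · refine (stdNormalCDF_le_exp (hj _ h)).trans (le_of_eq ?_)
      rw [discordantSq, Set.indicator_of_mem h]
      have : sgn (y i) ^ 2 = 1 := by cases y i <;> simp [sgn]
      rw [mul_pow, this]
      ring_nf
    · rw [discordantSq, Set.indicator_of_notMem h]
      simpa using (stdNormalCDF_lt_one _).le
  rw [posteriorWeight_eq]
  calc (∏ i, stdNormalCDF (sgn (y i) * inner ℝ (x i) β)) * Real.exp (-(1 / 2) * quad Q (β - v))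
      ≤ (∏ i, Real.exp (-(1 / 2) * discordantSq j β (x i, y i))) * 1 := by
        refine mul_le_mul (Finset.prod_le_prod (fun i _ => (stdNormalCDF_pos _).le)
          fun i _ => hterm i) (Real.exp_le_one_iff.2 ?_) (Real.exp_pos _).le
          (Finset.prod_nonneg fun i _ => (Real.exp_pos _).le)
        linarith [quad_nonneg hQ (β - v)]
    _ = Real.exp (-(1 / 2) * ∑ i, discordantSq j β (x i, y i)) := by
        rw [mul_one, ← Real.exp_sum, Finset.mul_sum]
    _ ≤ _ := Real.exp_le_exp.2 (by linarith [hd j β])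

lemma quad_smul (c : ℝ) (A : Matrix (Fin p) (Fin p) ℝ) (b : E p) :
    quad (c • A) b = c * quad A b := by
  simp [quad, Matrix.smul_mulVec]

/-- Domination by a Gaussian gives both propriety and moments, also under the flat prior. -/
lemma exists_posteriorMass_le {c : ℝ} (hc : 0 < c) (hQ : Q.PosSemidef)
    (hS : (precision Q x).PosDef)
    (hd : ∀ j b, c * quad (precision Q x) b ≤ ∑ i, discordantSq j b (x i, y i)) :
    ∃ k : ℝ≥0∞, k ≠ ⊤ ∧
      posteriorMass Q v x y ≤ k • multivariateGaussian 0 (c • precision Q x)⁻¹ := by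
  obtain ⟨k, -, hk, h⟩ := withDensity_exp_quad (hS.smul hc)
  refine ⟨k, hk, ?_⟩
  rw [← h 0, posteriorMass]
  refine withDensity_mono (ae_of_all _ fun β => ENNReal.ofReal_le_ofReal ?_)
  rw [sub_zero, quad_smul]
  exact posteriorWeight_le hQ hd β

lemma posteriorMass_univ_ne_zero : posteriorMass Q v x y Set.univ ≠ 0 := by
  rw [posteriorMass, withDensity_apply _ MeasurableSet.univ, Measure.restrict_univ, Ne,
    lintegral_eq_zero_iff measurable_posteriorWeight.ennreal_ofReal]
  intro h
  have h2 : ∀ᵐ _ ∂(volume : Measure (E p)), False := by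
    filter_upwards [h] with β hβ
    have := posteriorWeight_pos (Q := Q) (v := v) (x := x) (y := y) β
    simp at hβ
    linarith
  exact (NeZero.ne (volume : Measure (E p))) (by simpa using h2)

lemma quad_sub {A : Matrix (Fin p) (Fin p) ℝ} (hA : A.IsHermitian) (b m : E p) :
    quad A (b - m) = quad A b - 2 * (⇑b ⬝ᵥ (A *ᵥ ⇑m)) + quad A m := by
  have h : (⇑m : Fin p → ℝ) ⬝ᵥ (A *ᵥ ⇑b) = ⇑b ⬝ᵥ (A *ᵥ ⇑m) := by
    have hT : Aᵀ = A := by simpa using hA.eq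
    rw [Matrix.dotProduct_mulVec, ← Matrix.mulVec_transpose, hT, dotProduct_comm]
  have hb : (⇑(b - m) : Fin p → ℝ) = ⇑b - ⇑m := rfl
  rw [quad, hb, Matrix.mulVec_sub, sub_dotProduct, dotProduct_sub, dotProduct_sub, h, quad, quad]
  ring

/-- Completing the square in the joint density of the coefficients and the latent vector. -/
lemma sum_sq_add_quad_eq (hQ : Q.PosSemidef) (hS : (precision Q x).PosDef) (z : Fin n → ℝ) :
    ∃ D : ℝ, ∀ β : E p, ∑ i, (z i - inner ℝ (x i) β) ^ 2 + quad Q (β - v) =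
      quad (precision Q x) (β - coefMean Q v x z) + D := by
  refine ⟨∑ i, z i ^ 2 + quad Q v - quad (precision Q x) (coefMean Q v x z), fun β => ?_⟩
  have hdet : IsUnit (precision Q x).det := hS.det_pos.ne'.isUnit
  have hm : precision Q x *ᵥ ⇑(coefMean Q v x z) = (designMatrix x)ᵀ *ᵥ z + Q *ᵥ ⇑v := by
    change precision Q x *ᵥ ((precision Q x)⁻¹ *ᵥ ((designMatrix x)ᵀ *ᵥ z + Q *ᵥ ⇑v)) = _
    rw [Matrix.mulVec_mulVec, Matrix.mul_nonsing_inv _ hdet, Matrix.one_mulVec]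
  rw [quad_sub hS.1, quad_sub hQ.1, hm, dotProduct_add, dotProduct_designMatrix_transpose_mulVec,
    quad_precision Q x β]
  have h : ∑ i, (z i - inner ℝ (x i) β) ^ 2 =
      ∑ i, z i ^ 2 - 2 * ∑ i, inner ℝ (x i) β * z i + ∑ i, inner ℝ (x i) β ^ 2 := by
    rw [Finset.mul_sum, ← Finset.sum_sub_distrib, ← Finset.sum_add_distrib]
    exact Finset.sum_congr rfl fun i _ => by ring
  rw [h]
  ring

/-- The unnormalized joint density of the coefficients and the latent vector. -/
def jointWeight (Q : Matrix (Fin p) (Fin p) ℝ) (v : E p) (x : Fin n → E p) (y : Fin n → Bool)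
    (β : E p) (z : Fin n → ℝ) : ℝ :=
  (∏ i, (halfLine (y i)).indicator (fun t => stdNormalPDF (t - inner ℝ (x i) β)) (z i)) *
    Real.exp (-(1 / 2) * quad Q (β - v))

lemma measurable_jointWeight :
    Measurable fun q : E p × (Fin n → ℝ) => jointWeight Q v x y q.1 q.2 := by
  have h1 := continuous_quad Q
  have h2 := continuous_stdNormalPDF
  unfold jointWeight
  refine Measurable.mul (Finset.measurable_prod _ fun i _ => ?_) (by fun_prop)
  have h3 : (fun q : E p × (Fin n → ℝ) =>
      (halfLine (y i)).indicator (fun t => stdNormalPDF (t - inner ℝ (x i) q.1)) (q.2 i)) =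
      ((fun q : E p × (Fin n → ℝ) => q.2 i) ⁻¹' halfLine (y i)).indicator
        fun q => stdNormalPDF (q.2 i - inner ℝ (x i) q.1) := rfl
  rw [h3]
  exact (by fun_prop : Continuous fun q : E p × (Fin n → ℝ) =>
    stdNormalPDF (q.2 i - inner ℝ (x i) q.1)).measurable.indicator
      ((measurableSet_halfLine (y i)).preimage (by fun_prop))

/-- The likelihood factors are exactly the normalizing constants of the truncated normals, so they
cancel. -/
lemma posteriorWeight_mul_lintegral_latentKernel (β : E p) {f : (Fin n → ℝ) → ℝ≥0∞}
    (hf : Measurable f) :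
    ENNReal.ofReal (posteriorWeight Q v x y β) * ∫⁻ z, f z ∂latentKernel x y β =
      ∫⁻ z, ENNReal.ofReal (jointWeight Q v x y β z) * f z := by
  have hp (i : Fin n) := stdNormalCDF_pos (sgn (y i) * inner ℝ (x i) β)
  set g : Fin n → ℝ → ℝ := fun i t =>
    (halfLine (y i)).indicator (fun t => stdNormalPDF (t - inner ℝ (x i) β)) t /
      stdNormalCDF (sgn (y i) * inner ℝ (x i) β) with hg
  have hlat : latentKernel x y β =
      (volume : Measure (Fin n → ℝ)).withDensity fun z => ENNReal.ofReal (∏ i, g i (z i)) := by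
    change Measure.pi (fun i => truncNormal (inner ℝ (x i) β) (y i)) = _
    simp_rw [truncNormal_eq_withDensity]
    exact pi_withDensity (fun _ => volume)
      (fun i t => div_nonneg (Set.indicator_nonneg (fun _ _ => (stdNormalPDF_pos _).le) _)
        (hp i).le)
      (fun i => ((integrable_stdNormalPDF.comp_sub_right _).indicator
        (measurableSet_halfLine (y i))).div_const _)
  have hgm (i : Fin n) : Measurable (g i) :=
    (((continuous_stdNormalPDF.comp (continuous_sub_right _)).measurable).indicator
      (measurableSet_halfLine (y i))).div_const _
  have hgm' : Measurable fun z : Fin n → ℝ => ∏ i, g i (z i) := by fun_prop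
  rw [hlat, lintegral_withDensity_eq_lintegral_mul _ hgm'.ennreal_ofReal hf,
    ← lintegral_const_mul _ (hgm'.ennreal_ofReal.mul hf)]
  refine lintegral_congr fun z => ?_
  rw [Pi.mul_apply, ← mul_assoc, ← ENNReal.ofReal_mul (posteriorWeight_pos β).le]
  congr 2
  rw [posteriorWeight_eq, jointWeight, hg, Finset.prod_div_distrib]
  have := (Finset.prod_pos fun i (_ : i ∈ Finset.univ) => hp i).ne'
  field_simp

/-- For fixed `z` the joint weight is, by completing the square, a multiple of the density of
`coefKernel`; the multiple is identified by taking the whole space for `B`. -/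
lemma setLIntegral_jointWeight (hQ : Q.PosSemidef) (hS : (precision Q x).PosDef) (z : Fin n → ℝ)
    {B : Set (E p)} (hB : MeasurableSet B) :
    ∫⁻ β in B, ENNReal.ofReal (jointWeight Q v x y β z) =
      (∫⁻ β, ENNReal.ofReal (jointWeight Q v x y β z)) * coefKernel Q v x z B := by
  obtain ⟨D, hD⟩ := sum_sq_add_quad_eq (v := v) hQ hS z
  obtain ⟨k, -, -, hk⟩ := withDensity_exp_quad hS
  have hC : ∃ C : ℝ, 0 ≤ C ∧ ∀ β, jointWeight Q v x y β z =
      C * Real.exp (-(1 / 2) * quad (precision Q x) (β - coefMean Q v x z)) := by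
    refine ⟨(∏ i, (halfLine (y i)).indicator (fun _ => (√(2 * Real.pi))⁻¹) (z i)) *
      Real.exp (-(1 / 2) * D), mul_nonneg (Finset.prod_nonneg fun i _ =>
        Set.indicator_nonneg (fun _ _ => by positivity) _) (Real.exp_pos _).le, fun β => ?_⟩
    have h1 (i : Fin n) :
        (halfLine (y i)).indicator (fun t => stdNormalPDF (t - inner ℝ (x i) β)) (z i) =
        (halfLine (y i)).indicator (fun _ => (√(2 * Real.pi))⁻¹) (z i) *
          Real.exp (-(1 / 2) * (z i - inner ℝ (x i) β) ^ 2) := by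
      by_cases h : z i ∈ halfLine (y i)
      · rw [Set.indicator_of_mem h, Set.indicator_of_mem h, stdNormalPDF_eq]
        congr 2
        ring
      · simp [Set.indicator_of_notMem h]
    rw [jointWeight, Finset.prod_congr rfl fun i _ => h1 i, Finset.prod_mul_distrib, mul_assoc,
      mul_assoc, ← Real.exp_sum, ← Real.exp_add, ← Real.exp_add]
    congr 2
    rw [← Finset.mul_sum, ← mul_add, hD, mul_add, add_comm]
  obtain ⟨C, hC0, hC⟩ := hC
  have hm : Measurable fun β : E p =>
      ENNReal.ofReal (Real.exp (-(1 / 2) * quad (precision Q x) (β - coefMean Q v x z))) := by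
    have := continuous_quad (precision Q x)
    fun_prop
  have key {B : Set (E p)} (hB : MeasurableSet B) :
      ∫⁻ β in B, ENNReal.ofReal (jointWeight Q v x y β z) =
        ENNReal.ofReal C * k * coefKernel Q v x z B := by
    simp_rw [hC, ENNReal.ofReal_mul hC0]
    rw [lintegral_const_mul _ hm, ← withDensity_apply _ hB, hk, mul_assoc]
    rfl
  have huniv := key MeasurableSet.univ
  rw [Measure.restrict_univ, measure_univ, mul_one] at huniv
  rw [key hB, huniv]

/-- The posterior distribution is invariant, up to normalization. -/
lemma lintegral_chain_posteriorMass (hQ : Q.PosSemidef) (hS : (precision Q x).PosDef)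
    {A : Set (E p)} (hA : MeasurableSet A) :
    ∫⁻ β, chain Q v x y β A ∂posteriorMass Q v x y = posteriorMass Q v x y A := by
  have hj : Measurable (Function.uncurry fun β z => ENNReal.ofReal (jointWeight Q v x y β z)) :=
    measurable_jointWeight.ennreal_ofReal
  have hcm := (coefKernel Q v x).measurable_coe hA
  -- Data augmentation: the posterior is the marginal of the joint weight, and the chain alternates
  -- its two conditional laws. Tonelli's theorem switches between them.
  calc ∫⁻ β, chain Q v x y β A ∂posteriorMass Q v x y
      = ∫⁻ β, ENNReal.ofReal (posteriorWeight Q v x y β) *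
          ∫⁻ z, coefKernel Q v x z A ∂latentKernel x y β := by
        rw [posteriorMass, lintegral_withDensity_eq_lintegral_mul _
          measurable_posteriorWeight.ennreal_ofReal ((chain Q v x y).measurable_coe hA)]
        refine lintegral_congr fun β => ?_
        rw [Pi.mul_apply, chain, Kernel.comp_apply' _ _ _ hA]
    _ = ∫⁻ β, ∫⁻ z, ENNReal.ofReal (jointWeight Q v x y β z) * coefKernel Q v x z A :=
        lintegral_congr fun β => posteriorWeight_mul_lintegral_latentKernel β hcm
    _ = ∫⁻ z, ∫⁻ β, ENNReal.ofReal (jointWeight Q v x y β z) * coefKernel Q v x z A :=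
        lintegral_lintegral_swap (hj.mul (hcm.comp measurable_snd)).aemeasurable
    _ = ∫⁻ z, ∫⁻ β in A, ENNReal.ofReal (jointWeight Q v x y β z) := by
        refine lintegral_congr fun z => ?_
        rw [lintegral_mul_const _ hj.of_uncurry_right, setLIntegral_jointWeight hQ hS z hA]
    _ = ∫⁻ β in A, ∫⁻ z, ENNReal.ofReal (jointWeight Q v x y β z) :=
        (lintegral_lintegral_swap hj.aemeasurable).symm
    _ = ∫⁻ β in A, ENNReal.ofReal (posteriorWeight Q v x y β) := by
        refine lintegral_congr fun β => ?_
        have := posteriorWeight_mul_lintegral_latentKernel (Q := Q) (v := v) (x := x) (y := y) β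
          (f := 1) measurable_one
        simpa using this.symm
    _ = posteriorMass Q v x y A := (withDensity_apply _ hA).symm

lemma invariant_chain_posterior (hQ : Q.PosSemidef) (hS : (precision Q x).PosDef) (m : ℕ) :
    Kernel.Invariant (chain Q v x y ^ m) (posterior Q v x y) := by
  have h1 : Kernel.Invariant (chain Q v x y) (posterior Q v x y) := by
    refine Measure.ext fun A hA => ?_
    rw [Measure.bind_apply hA (Kernel.aemeasurable _), posterior, lintegral_smul_measure,
      lintegral_chain_posteriorMass hQ hS hA, Measure.smul_apply]
  induction m with
  | zero =>
    rw [pow_zero]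
    exact Measure.bind_dirac
  | succ m ih =>
    rw [pow_succ]
    exact ih.comp h1

lemma isProbabilityMeasure_posterior {c : ℝ} (hc : 0 < c) (hQ : Q.PosSemidef)
    (hS : (precision Q x).PosDef)
    (hd : ∀ j b, c * quad (precision Q x) b ≤ ∑ i, discordantSq j b (x i, y i)) :
    IsProbabilityMeasure (posterior Q v x y) := by
  obtain ⟨k, hk, hle⟩ := exists_posteriorMass_le (v := v) hc hQ hS hd
  refine ⟨?_⟩
  rw [posterior, Measure.smul_apply, smul_eq_mul]
  refine ENNReal.inv_mul_cancel posteriorMass_univ_ne_zero (ne_top_of_le_ne_top ?_ (hle Set.univ))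
  rw [Measure.smul_apply, smul_eq_mul, measure_univ, mul_one]
  exact hk

lemma integrable_sqrt_quad_posterior {c : ℝ} (hc : 0 < c) (hQ : Q.PosSemidef)
    (hS : (precision Q x).PosDef)
    (hd : ∀ j b, c * quad (precision Q x) b ≤ ∑ i, discordantSq j b (x i, y i)) (β : E p) :
    Integrable (fun b => √(quad (precision Q x) (β - b))) (posterior Q v x y) := by
  obtain ⟨k, hk, hle⟩ := exists_posteriorMass_le (v := v) hc hQ hS hd
  obtain ⟨e, -, hq⟩ := exists_standardization hS
  have hnorm (b : E p) : √(quad (precision Q x) (β - b)) = ‖e.symm β - e.symm b‖ := by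
    rw [← map_sub, ← Real.sqrt_sq (norm_nonneg (e.symm (β - b))), ← hq, e.apply_symm_apply]
  simp_rw [hnorm]
  have hint : Integrable (fun b => ‖e.symm β - e.symm b‖)
      (multivariateGaussian 0 (c • precision Q x)⁻¹) := by
    refine ((integrable_const _).sub ?_).norm
    exact (e.symm : E p →L[ℝ] E p).integrable_comp IsGaussian.integrable_id
  rw [posterior]
  exact ((hint.smul_measure hk).mono_measure hle).smul_measure
    (ENNReal.inv_ne_top.2 posteriorMass_univ_ne_zero)

/-! ### The convergence rate -/

lemma rate_nonneg (Q : Matrix (Fin p) (Fin p) ℝ) (v : E p) (x : Fin n → E p) (y : Fin n → Bool) :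
    0 ≤ rate Q v x y :=
  Real.sInf_nonneg fun _ h => h.1

/-- By invariance `π A` is the `π`-average of `K^m(b, A)`, so the distance to `π` is at most an
average of distances between chains started at `β` and at `b`. -/
theorem rate_le {c : ℝ} (hc : 0 < c) (hc2 : c < 2) (hQ : Q.PosSemidef)
    (hS : (precision Q x).PosDef)
    (hd : ∀ j b, c * quad (precision Q x) b ≤ ∑ i, discordantSq j b (x i, y i)) :
    rate Q v x y ≤ √(1 - c / 2) := by
  set s := √(1 - c / 2) with hs
  have hπ := isProbabilityMeasure_posterior (v := v) hc hQ hS hd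
  set π := posterior Q v x y with hπd
  obtain ⟨C, hC, hlip⟩ := abs_chain_pow_real_sub_le (v := v) hc2 hQ hS hd
  have hI0 (β : E p) : 0 ≤ ∫ b, √(quad (precision Q x) (β - b)) ∂π :=
    integral_nonneg fun _ => Real.sqrt_nonneg _
  -- The integral in `M` serves `m ≥ 1`; the added 1 covers `m = 0`, where no contraction is
  -- available.
  refine csInf_le ⟨0, fun _ h => h.1⟩ ⟨Real.sqrt_nonneg _, Real.sqrt_le_one.2 (by linarith),
    fun β => C * ∫ b, √(quad (precision Q x) (β - b)) ∂π + 1,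
    fun β => by have := hI0 β; positivity, fun β m => ?_⟩
  have : Nonempty {A : Set (E p) // MeasurableSet A} := ⟨⟨∅, MeasurableSet.empty⟩⟩
  refine ciSup_le fun ⟨A, hA⟩ => ?_
  have hsm : 0 ≤ s ^ m := by positivity
  dsimp only
  rcases m with _ | m
  · have h1 := measureReal_nonneg (μ := (chain Q v x y ^ 0) β) (s := A)
    have h2 := measureReal_nonneg (μ := π) (s := A)
    have h3 := measureReal_le_one (μ := (chain Q v x y ^ 0) β) (s := A)
    have h4 := measureReal_le_one (μ := π) (s := A)
    have h5 := mul_nonneg hC.le (hI0 β)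
    rw [pow_zero s, mul_one]
    exact abs_le.2 ⟨by linarith, by linarith⟩
  · have hmeas : Measurable fun b => ((chain Q v x y ^ (m + 1)) b).real A :=
      ((chain Q v x y ^ (m + 1)).measurable_coe hA).ennreal_toReal
    have hint : Integrable (fun b => ((chain Q v x y ^ (m + 1)) b).real A) π := by
      refine Integrable.of_bound hmeas.aestronglyMeasurable 1 (ae_of_all _ fun b => ?_)
      rw [Real.norm_of_nonneg measureReal_nonneg]
      exact measureReal_le_one
    have hinv : π.real A = ∫ b, ((chain Q v x y ^ (m + 1)) b).real A ∂π := by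
      have h : ∫⁻ b, (chain Q v x y ^ (m + 1)) b A ∂π = π A := by
        rw [← Measure.bind_apply hA (Kernel.aemeasurable _)]
        exact congrArg (fun μ => μ A) (invariant_chain_posterior hQ hS (m + 1)).def
      simp_rw [measureReal_def]
      rw [integral_toReal ((chain Q v x y ^ (m + 1)).measurable_coe hA).aemeasurable
        (ae_of_all _ fun b => measure_lt_top _ _), h]
    have hconst : ((chain Q v x y ^ (m + 1)) β).real A =
        ∫ _, ((chain Q v x y ^ (m + 1)) β).real A ∂π := by simp
    have hqi := integrable_sqrt_quad_posterior (v := v) hc hQ hS hd β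
    rw [hinv, hconst, ← integral_sub (integrable_const _) hint]
    calc |∫ b, (((chain Q v x y ^ (m + 1)) β).real A - ((chain Q v x y ^ (m + 1)) b).real A) ∂π|
        ≤ ∫ b, |((chain Q v x y ^ (m + 1)) β).real A - ((chain Q v x y ^ (m + 1)) b).real A| ∂π :=
          abs_integral_le_integral_abs
      _ ≤ ∫ b, C * s ^ (m + 1) * √(quad (precision Q x) (β - b)) ∂π :=
          integral_mono ((integrable_const _).sub hint).abs (hqi.const_mul _)
            fun b => hlip m β b A hA
      _ = C * s ^ (m + 1) * ∫ b, √(quad (precision Q x) (β - b)) ∂π := integral_const_mul _ _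
      _ ≤ _ := by linarith

end Posterior

/-! ### Quadratic forms and limits of matrices -/

section QuadLimit

variable {p : ℕ}

lemma quad_eq_sum (A : Matrix (Fin p) (Fin p) ℝ) (b : E p) :
    quad A b = ∑ k, ∑ l, A k l * (b k * b l) := by
  simp only [quad, dotProduct, Matrix.mulVec, Finset.mul_sum]
  exact Finset.sum_congr rfl fun k _ => Finset.sum_congr rfl fun l _ => by ring

lemma abs_quad_le (A : Matrix (Fin p) (Fin p) ℝ) (b : E p) :
    |quad A b| ≤ (∑ k, ∑ l, |A k l|) * ‖b‖ ^ 2 := by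
  rw [quad_eq_sum, Finset.sum_mul]
  refine (Finset.abs_sum_le_sum_abs _ _).trans (Finset.sum_le_sum fun k _ => ?_)
  rw [Finset.sum_mul]
  refine (Finset.abs_sum_le_sum_abs _ _).trans (Finset.sum_le_sum fun l _ => ?_)
  rw [abs_mul, abs_mul, sq]
  have h1 : |b k| ≤ ‖b‖ := PiLp.norm_apply_le b k
  have h2 : |b l| ≤ ‖b‖ := PiLp.norm_apply_le b l
  gcongr

/-- Minimize over the compact unit sphere and use homogeneity. -/
lemma exists_mul_norm_sq_le_quad {A : Matrix (Fin p) (Fin p) ℝ}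
    (hA : ∀ b : E p, b ≠ 0 → 0 < quad A b) :
    ∃ a : ℝ, 0 < a ∧ ∀ b : E p, a * ‖b‖ ^ 2 ≤ quad A b := by
  rcases (Metric.sphere (0 : E p) 1).eq_empty_or_nonempty with h | h
  -- The sphere is empty only if the space is trivial, that is for `p = 0`.
  · refine ⟨1, one_pos, fun b => ?_⟩
    rcases eq_or_ne b 0 with rfl | hb
    · simp [quad]
    · have : ‖b‖⁻¹ • b ∈ Metric.sphere (0 : E p) 1 := by
        simp [norm_smul, inv_mul_cancel₀ (norm_ne_zero_iff.2 hb)]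
      rw [h] at this
      exact this.elim
  · obtain ⟨b0, hb0, hmin⟩ := (isCompact_sphere (0 : E p) 1).exists_isMinOn h
      (continuous_quad A).continuousOn
    have hne : b0 ≠ 0 := by
      rintro rfl
      simp at hb0
    refine ⟨quad A b0, hA b0 hne, fun b => ?_⟩
    rcases eq_or_ne b 0 with rfl | hb
    · simp [quad]
    · have hn : 0 < ‖b‖ := norm_pos_iff.2 hb
      have hs : ‖b‖⁻¹ • b ∈ Metric.sphere (0 : E p) 1 := by
        simp [norm_smul, inv_mul_cancel₀ hn.ne']
      have h1 : quad A b0 ≤ quad A (‖b‖⁻¹ • b) := hmin hs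
      have h2 : quad A (‖b‖⁻¹ • b) = quad A b / ‖b‖ ^ 2 := by
        simp only [quad_eq_sum, PiLp.smul_apply, smul_eq_mul, Finset.sum_div]
        refine Finset.sum_congr rfl fun k _ => Finset.sum_congr rfl fun l _ => ?_
        field_simp
      rw [h2, le_div_iff₀ (by positivity)] at h1
      exact h1

lemma eventually_abs_quad_sub_le {M : ℕ → Matrix (Fin p) (Fin p) ℝ} {A : Matrix (Fin p) (Fin p) ℝ}
    (h : ∀ k l, Tendsto (fun n => M n k l) atTop (𝓝 (A k l))) {ε : ℝ} (hε : 0 < ε) :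
    ∀ᶠ n in atTop, ∀ b : E p, |quad (M n) b - quad A b| ≤ ε * ‖b‖ ^ 2 := by
  have h1 : Tendsto (fun n => ∑ k, ∑ l, |(M n - A) k l|) atTop (𝓝 0) := by
    have : Tendsto (fun n => ∑ k, ∑ l, |(M n - A) k l|) atTop
        (𝓝 (∑ k : Fin p, ∑ l : Fin p, |A k l - A k l|)) :=
      tendsto_finsetSum _ fun k _ => tendsto_finsetSum _ fun l _ =>
        ((h k l).sub tendsto_const_nhds).abs
    simpa using this
  filter_upwards [h1.eventually_lt_const hε] with n hn b
  have h2 : quad (M n) b - quad A b = quad (M n - A) b := by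
    simp [quad, Matrix.sub_mulVec]
  rw [h2]
  exact (abs_quad_le _ b).trans (by gcongr)

end QuadLimit

/-! ### The discordant observations of a random sample -/

section Sample

variable {p : ℕ}

lemma measurableSet_orthant (j : Fin p → Bool) : MeasurableSet (orthant j) := by
  have : orthant j = ⋂ k, {x : E p | if j k = true then 0 < x k else x k < 0} := by
    ext x; simp [orthant]
  rw [this]
  refine MeasurableSet.iInter fun k => ?_
  by_cases h : j k = true
  · simp only [h, if_true]
    exact measurableSet_lt measurable_const (by fun_prop)
  · simp only [h]
    exact measurableSet_lt (by fun_prop) measurable_const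

lemma measurableSet_discordant (j : Fin p → Bool) : MeasurableSet (discordant j) := by
  refine MeasurableSet.union (MeasurableSet.inter ?_ ?_) (MeasurableSet.inter ?_ ?_)
  · exact measurable_snd (measurableSet_singleton false)
  · exact measurable_fst (measurableSet_orthant j)
  · exact measurable_snd (measurableSet_singleton true)
  · exact measurable_fst.neg (measurableSet_orthant j)

/-- The contribution of an observation to the matrix of the quadratic form `discordantSq`. -/
def discordantEntry (j : Fin p → Bool) (k l : Fin p) (d : E p × Bool) : ℝ :=
  (discordant j).indicator (fun d => d.1 k * d.1 l) d

lemma measurable_discordantEntry (j : Fin p → Bool) (k l : Fin p) :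
    Measurable (discordantEntry j k l) :=
  Measurable.indicator (by fun_prop) (measurableSet_discordant j)

lemma inner_sq_eq_sum (x b : E p) :
    inner ℝ x b ^ 2 = ∑ k, ∑ l, x k * x l * (b k * b l) := by
  rw [PiLp.inner_apply, sq, Finset.sum_mul_sum]
  refine Finset.sum_congr rfl fun k _ => Finset.sum_congr rfl fun l _ => ?_
  simp only [RCLike.inner_apply, conj_trivial]
  ring

lemma discordantSq_eq_sum (j : Fin p → Bool) (b : E p) (d : E p × Bool) :
    discordantSq j b d = ∑ k, ∑ l, discordantEntry j k l d * (b k * b l) := by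
  by_cases h : d ∈ discordant j
  · simp only [discordantSq, discordantEntry, Set.indicator_of_mem h, inner_sq_eq_sum]
  · simp [discordantSq, discordantEntry, Set.indicator_of_notMem h]

lemma discordantSq_nonneg (j : Fin p → Bool) (b : E p) (d : E p × Bool) :
    0 ≤ discordantSq j b d :=
  Set.indicator_nonneg (fun _ _ => sq_nonneg _) d

lemma discordantSq_le (j : Fin p → Bool) (b : E p) (d : E p × Bool) :
    discordantSq j b d ≤ inner ℝ d.1 b ^ 2 :=
  Set.indicator_le_self' (fun _ _ => sq_nonneg _) d

variable {Ω : Type*} [MeasurableSpace Ω] {P : Measure Ω}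

/-- A covariate event of positive probability occurs together with each of the responses with
positive probability. -/
lemma measure_inter_response_pos [IsProbabilityMeasure P] {X : Ω → E p} {Y : Ω → Bool}
    (hX : Measurable X) (hY : Measurable Y) {G : E p → ℝ} (hG01 : ∀ x, 0 < G x ∧ G x < 1)
    (hbern : P⟦Y ⁻¹' {true} | MeasurableSpace.comap X inferInstance⟧ =ᵐ[P] fun ω => G (X ω))
    {S : Set (E p)} (hS : MeasurableSet S) (hpos : P (X ⁻¹' S) ≠ 0) (t : Bool) :
    P (X ⁻¹' S ∩ Y ⁻¹' {t}) ≠ 0 := by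
  have hYm (t : Bool) : MeasurableSet (Y ⁻¹' {t}) := hY (measurableSet_singleton t)
  have hSm : MeasurableSet (X ⁻¹' S) := hX hS
  have hGi : Integrable (fun ω => G (X ω)) P := integrable_condExp.congr hbern
  have htrue : ∫ ω in X ⁻¹' S, G (X ω) ∂P = P.real (X ⁻¹' S ∩ Y ⁻¹' {true}) := by
    rw [← setIntegral_congr_ae (g := fun ω => G (X ω)) hSm (hbern.mono fun ω h _ => h),
      setIntegral_condExp hX.comap_le ((integrable_const 1).indicator (hYm true)) ⟨S, hS, rfl⟩,
      setIntegral_indicator (hYm true)]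
    simp
  have key {f : Ω → ℝ} (hf : Integrable f P) (hf0 : ∀ ω, 0 < f ω) :
      0 < ∫ ω in X ⁻¹' S, f ω ∂P := by
    refine (setIntegral_pos_iff_support_of_nonneg_ae (ae_of_all _ fun ω => (hf0 ω).le)
      hf.integrableOn).2 ?_
    have : Function.support f = Set.univ := Set.eq_univ_of_forall fun ω => (hf0 ω).ne'
    rw [this, Set.univ_inter]
    exact pos_iff_ne_zero.2 hpos
  intro h0
  cases t
  · have h1 := key ((integrable_const 1).sub hGi) fun ω => sub_pos.2 (hG01 (X ω)).2
    have h2 : ∫ ω in X ⁻¹' S, (1 - G (X ω)) ∂P = P.real (X ⁻¹' S ∩ Y ⁻¹' {false}) := by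
      rw [integral_sub (integrable_const _) hGi.integrableOn, htrue]
      have h3 := measureReal_inter_add_sdiff (μ := P) (s := X ⁻¹' S) (hYm true)
      have h4 : X ⁻¹' S \ Y ⁻¹' {true} = X ⁻¹' S ∩ Y ⁻¹' {false} := by
        ext ω; simp
      rw [h4] at h3
      simp
      linarith
    simp only [Pi.sub_apply] at h1
    rw [h2, measureReal_def, h0] at h1
    simp at h1
  · have h1 := key hGi fun ω => (hG01 (X ω)).1
    rw [htrue, measureReal_def, h0] at h1
    simp at h1

/-- The event in (A3) splits into `X ∈ S` and `-X ∈ S`. As neither response is excluded given `X`,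
the discordant response occurs with positive probability on whichever part is not null. -/
lemma integral_discordantSq_pos [IsProbabilityMeasure P] {X : Ω → E p} {Y : Ω → Bool}
    (hX : Measurable X) (hY : Measurable Y) {G : E p → ℝ} (hG01 : ∀ x, 0 < G x ∧ G x < 1)
    (hbern : P⟦Y ⁻¹' {true} | MeasurableSpace.comap X inferInstance⟧ =ᵐ[P] fun ω => G (X ω))
    (j : Fin p → Bool) {b : E p}
    (hint : Integrable (fun ω => discordantSq j b (X ω, Y ω)) P)
    (hA3 : 0 < P {ω | ((orthant j).indicator (fun _ => (1 : ℝ)) (X ω) +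
        (orthant j).indicator (fun _ => (1 : ℝ)) (-X ω)) * inner ℝ (X ω) b ≠ 0}) :
    0 < ∫ ω, discordantSq j b (X ω, Y ω) ∂P := by
  rw [integral_pos_iff_support_of_nonneg (fun ω => discordantSq_nonneg _ _ _) hint]
  refine pos_iff_ne_zero.2 fun h0 => hA3.ne' ?_
  have hne : MeasurableSet {x : E p | inner ℝ x b ≠ 0} :=
    (measurableSet_eq_fun (by fun_prop) measurable_const).compl
  have h1 : P (X ⁻¹' (orthant j ∩ {x | inner ℝ x b ≠ 0})) = 0 := by
    by_contra h
    refine measure_inter_response_pos hX hY hG01 hbern ((measurableSet_orthant j).inter hne) h false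
      (measure_mono_null ?_ h0)
    rintro ω ⟨⟨h1, h2⟩, h3⟩
    have h4 : (X ω, Y ω) ∈ discordant j := Or.inl ⟨h3, h1⟩
    rw [Function.mem_support, discordantSq, Set.indicator_of_mem h4]
    exact pow_ne_zero 2 h2
  have h2 : P (X ⁻¹' ({x | -x ∈ orthant j} ∩ {x | inner ℝ x b ≠ 0})) = 0 := by
    by_contra h
    refine measure_inter_response_pos hX hY hG01 hbern
      ((measurable_neg (measurableSet_orthant j)).inter hne) h true (measure_mono_null ?_ h0)
    rintro ω ⟨⟨h1, h2⟩, h3⟩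
    have h4 : (X ω, Y ω) ∈ discordant j := Or.inr ⟨h3, h1⟩
    rw [Function.mem_support, discordantSq, Set.indicator_of_mem h4]
    exact pow_ne_zero 2 h2
  refine measure_mono_null ?_ (measure_union_null h1 h2)
  intro ω hω
  have h3 : inner ℝ (X ω) b ≠ 0 := right_ne_zero_of_mul hω
  by_cases h4 : X ω ∈ orthant j
  · exact Or.inl ⟨h4, h3⟩
  · by_cases h5 : -X ω ∈ orthant j
    · exact Or.inr ⟨h5, h3⟩
    · simp [h4, h5] at hω

lemma ae_tendsto_average {S : Type*} [MeasurableSpace S] {D : ℕ → Ω → S}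
    (hindep : iIndepFun D P) (hident : ∀ i, IdentDistrib (D i) (D 0) P P) {f : S → ℝ}
    (hf : Measurable f) (hint : Integrable (fun ω => f (D 0 ω)) P) :
    ∀ᵐ ω ∂P, Tendsto (fun n : ℕ => (∑ i : Fin n, f (D i ω)) / n) atTop (𝓝 (∫ ω, f (D 0 ω) ∂P)) := by
  have h := strong_law_ae_real (μ := P) (fun i ω => f (D i ω)) hint
    (fun i k hik => (hindep.indepFun hik).comp hf hf) (fun i => (hident i).comp hf)
  filter_upwards [h] with ω hω
  simpa only [Finset.sum_range] using hω

end Sample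

/-! ### A uniform rate bound from convergent averages -/

section Asymptotics

variable {p : ℕ}

/-- If the averages of the matrices of the discordant observations and of all observations converge,
then the discordant observations eventually make up a fixed proportion of the precision matrix. -/
lemma exists_eventually_rate_le {Q : Matrix (Fin p) (Fin p) ℝ} (hQ : Q.PosSemidef) (v : E p)
    {A : (Fin p → Bool) → Matrix (Fin p) (Fin p) ℝ} (M : Matrix (Fin p) (Fin p) ℝ)
    (hA : ∀ j b, b ≠ 0 → 0 < quad (A j) b) :
    ∃ ρ : ℝ, ρ < 1 ∧ ∀ (x : ℕ → E p) (y : ℕ → Bool),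
      (∀ j k l, Tendsto (fun n : ℕ => (∑ i : Fin n, discordantEntry j k l (x i, y i)) / n) atTop
        (𝓝 (A j k l))) →
      (∀ k l, Tendsto (fun n : ℕ => (∑ i : Fin n, x i k * x i l) / n) atTop (𝓝 (M k l))) →
      ∀ᶠ n : ℕ in atTop, rate Q v (fun i : Fin n => x i) (fun i : Fin n => y i) ≤ ρ := by
  choose a ha haA using fun j => exists_mul_norm_sq_le_quad (hA j)
  obtain ⟨j0, hj0⟩ := Finite.exists_min a
  set a0 := a j0 with ha0
  have ha0p : 0 < a0 := ha j0
  set B := ∑ k, ∑ l, |M k l| with hB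
  set κ := ∑ k, ∑ l, |Q k l| with hκ
  have hB0 : 0 ≤ B := Finset.sum_nonneg fun _ _ => Finset.sum_nonneg fun _ _ => abs_nonneg _
  have hκ0 : 0 ≤ κ := Finset.sum_nonneg fun _ _ => Finset.sum_nonneg fun _ _ => abs_nonneg _
  -- Divided by `n`, the discordant forms are eventually at least `(a0 / 2) ‖b‖²` and the form of
  -- `Σ` is at most `(B + 1 + κ) ‖b‖²`. The minimum with 1 keeps `c < 2`.
  set c := min (a0 / 2 / (B + 1 + κ)) 1 with hc
  have hc0 : 0 < c := lt_min (by positivity) one_pos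
  have hc1 : c ≤ 1 := min_le_right _ _
  have hca : c * (B + 1 + κ) ≤ a0 / 2 := by
    rw [← le_div_iff₀ (by positivity)]
    exact min_le_left _ _
  refine ⟨√(1 - c / 2), (Real.sqrt_lt' one_pos).2 (by linarith), fun x y hAlim hMlim => ?_⟩
  have h1 : ∀ᶠ n : ℕ in atTop, ∀ j, ∀ b : E p,
      |quad (Matrix.of fun k l => (∑ i : Fin n, discordantEntry j k l (x i, y i)) / n) b -
        quad (A j) b| ≤ a0 / 2 * ‖b‖ ^ 2 :=
    eventually_all.2 fun j => eventually_abs_quad_sub_le (hAlim j) (by positivity)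
  have h2 : ∀ᶠ n : ℕ in atTop, ∀ b : E p,
      |quad (Matrix.of fun k l => (∑ i : Fin n, x i k * x i l) / n) b - quad M b| ≤
        1 * ‖b‖ ^ 2 := eventually_abs_quad_sub_le hMlim one_pos
  filter_upwards [h1, h2, eventually_ge_atTop 1] with n h1 h2 hn
  have hn1 : (1 : ℝ) ≤ n := by exact_mod_cast hn
  have hn0 : (0 : ℝ) < n := one_pos.trans_le hn1
  have hdq (j : Fin p → Bool) (b : E p) : ∑ i : Fin n, discordantSq j b (x i, y i) =
      n * quad (Matrix.of fun k l => (∑ i : Fin n, discordantEntry j k l (x i, y i)) / n) b := by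
    simp_rw [discordantSq_eq_sum, quad_eq_sum, Matrix.of_apply, Finset.mul_sum]
    rw [Finset.sum_comm]
    refine Finset.sum_congr rfl fun k _ => ?_
    rw [Finset.sum_comm]
    refine Finset.sum_congr rfl fun l _ => ?_
    rw [← Finset.sum_mul]
    field_simp
  have hMq (b : E p) : ∑ i : Fin n, inner ℝ (x i) b ^ 2 =
      n * quad (Matrix.of fun k l => (∑ i : Fin n, x i k * x i l) / n) b := by
    simp_rw [inner_sq_eq_sum, quad_eq_sum, Matrix.of_apply, Finset.mul_sum]
    rw [Finset.sum_comm]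
    refine Finset.sum_congr rfl fun k _ => ?_
    rw [Finset.sum_comm]
    refine Finset.sum_congr rfl fun l _ => ?_
    rw [← Finset.sum_mul]
    field_simp
  have hlow (j : Fin p → Bool) (b : E p) :
      n * (a0 / 2 * ‖b‖ ^ 2) ≤ ∑ i : Fin n, discordantSq j b (x i, y i) := by
    rw [hdq]
    refine mul_le_mul_of_nonneg_left ?_ hn0.le
    have h3 := (abs_le.1 (h1 j b)).1
    have h4 := haA j b
    have h5 := mul_le_mul_of_nonneg_right (hj0 j) (sq_nonneg ‖b‖)
    linarith
  have hup (b : E p) : quad (precision Q fun i : Fin n => x i) b ≤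
      n * ((B + 1 + κ) * ‖b‖ ^ 2) := by
    rw [quad_precision, hMq]
    have h3 := (abs_le.1 (h2 b)).2
    have h4 := (le_abs_self _).trans (abs_quad_le M b)
    have h5 := (le_abs_self _).trans (abs_quad_le Q b)
    have h6 : quad (Matrix.of fun k l => (∑ i : Fin n, x i k * x i l) / n) b ≤
        (B + 1) * ‖b‖ ^ 2 := by linarith
    have h7 := mul_le_mul_of_nonneg_left h6 hn0.le
    have h8 : κ * ‖b‖ ^ 2 ≤ n * (κ * ‖b‖ ^ 2) := le_mul_of_one_le_left (by positivity) hn1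
    linarith
  have hd (j : Fin p → Bool) (b : E p) : c * quad (precision Q fun i : Fin n => x i) b ≤
      ∑ i : Fin n, discordantSq j b (x i, y i) := by
    refine le_trans ?_ (hlow j b)
    calc c * quad (precision Q fun i : Fin n => x i) b
        ≤ c * (n * ((B + 1 + κ) * ‖b‖ ^ 2)) := mul_le_mul_of_nonneg_left (hup b) hc0.le
      _ = n * (c * (B + 1 + κ) * ‖b‖ ^ 2) := by ring
      _ ≤ n * (a0 / 2 * ‖b‖ ^ 2) := by gcongr
  -- The discordant observations of a single orthant already make the form positive.
  have hS : (precision Q fun i : Fin n => x i).PosDef := by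
    refine Matrix.PosDef.of_dotProduct_mulVec_pos (isHermitian_precision hQ _) fun b hb => ?_
    have hb' : WithLp.toLp 2 b ≠ (0 : E p) := fun h => hb (by simpa using h)
    have h3 : 0 < n * (a0 / 2 * ‖(WithLp.toLp 2 b : E p)‖ ^ 2) := by
      have := norm_pos_iff.2 hb'
      positivity
    have h4 : ∑ i : Fin n, discordantSq j0 (WithLp.toLp 2 b) (x i, y i) ≤
        ∑ i : Fin n, inner ℝ (x i) (WithLp.toLp 2 b : E p) ^ 2 :=
      Finset.sum_le_sum fun i _ => discordantSq_le _ _ _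
    have h5 := quad_precision Q (fun i : Fin n => x i) (WithLp.toLp 2 b)
    have h6 := quad_nonneg hQ (WithLp.toLp 2 b)
    have h7 := hlow j0 (WithLp.toLp 2 b)
    change 0 < quad (precision Q fun i : Fin n => x i) (WithLp.toLp 2 b)
    linarith
  exact rate_le hc0 (by linarith) hQ hS hd

end Asymptotics

end AlbertChib

end

/-! ### The main theorem -/

theorem theorem2 {Ω : Type*} [MeasurableSpace Ω] (P : Measure Ω) [IsProbabilityMeasure P]
    (p : ℕ) (Q : Matrix (Fin p) (Fin p) ℝ) (v : EuclideanSpace ℝ (Fin p))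
    -- proper Gaussian prior or flat prior
    (hQ : Q.PosDef ∨ Q = 0)
    (X : ℕ → Ω → EuclideanSpace ℝ (Fin p)) (Y : ℕ → Ω → Bool)
    (hX : ∀ i, Measurable (X i)) (hY : ∀ i, Measurable (Y i))
    -- iid pairs with `Y_i | X_i ∼ Bernoulli (G (X_i))`
    (hindep : iIndepFun (fun i ω => (X i ω, Y i ω)) P)
    (hident : ∀ i, IdentDistrib (fun ω => (X i ω, Y i ω)) (fun ω => (X 0 ω, Y 0 ω)) P P)
    (G : EuclideanSpace ℝ (Fin p) → ℝ) (hG : Measurable G) (hG01 : ∀ x, 0 < G x ∧ G x < 1)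
    (hbern : ∀ i, P⟦Y i ⁻¹' {true} | MeasurableSpace.comap (X i) inferInstance⟧
      =ᵐ[P] fun ω => G (X i ω))
    -- the second moment matrix of the covariates is finite and positive definite
    (hint : ∀ k l, Integrable (fun ω => X 0 ω k * X 0 ω l) P)
    (hpos : (Matrix.of fun k l => ∫ ω, X 0 ω k * X 0 ω l ∂P).PosDef)
    -- for every open orthant `S` and `β ≠ 0`, `(1_S(X_1) + 1_S(-X_1)) X_1ᵀβ` is not a.s. zero
    (hA3 : ∀ (j : Fin p → Bool) (β : EuclideanSpace ℝ (Fin p)), β ≠ 0 →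
      0 < P {ω | ((AlbertChib.orthant j).indicator (fun _ => (1 : ℝ)) (X 0 ω) +
        (AlbertChib.orthant j).indicator (fun _ => (1 : ℝ)) (-X 0 ω)) *
          inner ℝ (X 0 ω) β ≠ 0}) :
    ∃ ρ : ℝ, ρ < 1 ∧ ∀ᵐ ω ∂P,
      limsup (fun n : ℕ => AlbertChib.rate Q v (fun i : Fin n => X i ω) (fun i : Fin n => Y i ω))
        atTop ≤ ρ := by

  have hQ' : Q.PosSemidef := by
    rcases hQ with h | rfl
    · exact h.posSemidef
    · exact Matrix.PosSemidef.zero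
  set D : ℕ → Ω → AlbertChib.E p × Bool := fun i ω => (X i ω, Y i ω) with hD
  have hD0 : Measurable (D 0) := (hX 0).prodMk (hY 0)
  have hentry (j : Fin p → Bool) (k l : Fin p) :
      Integrable (fun ω => AlbertChib.discordantEntry j k l (D 0 ω)) P := by
    refine (hint k l).mono ((AlbertChib.measurable_discordantEntry j k l).comp
      hD0).aestronglyMeasurable (ae_of_all _ fun ω => ?_)
    exact norm_indicator_le_norm_self (fun d : AlbertChib.E p × Bool => d.1 k * d.1 l) (D 0 ω)
  have hsq (j : Fin p → Bool) (b : AlbertChib.E p) :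
      Integrable (fun ω => AlbertChib.discordantSq j b (D 0 ω)) P := by
    simp_rw [AlbertChib.discordantSq_eq_sum]
    exact integrable_finsetSum _ fun k _ => integrable_finsetSum _ fun l _ =>
      (hentry j k l).mul_const _
  -- The form of the limit matrix at `b` is the expectation of `discordantSq j b`.
  have hpos' (j : Fin p → Bool) (b : AlbertChib.E p) (hb : b ≠ 0) : 0 < AlbertChib.quad
      (Matrix.of fun k l => ∫ ω, AlbertChib.discordantEntry j k l (D 0 ω) ∂P) b := by
    have h := AlbertChib.integral_discordantSq_pos (hX 0) (hY 0) hG01 (hbern 0) j (hsq j b)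
      (hA3 j b hb)
    refine h.trans_eq ?_
    simp_rw [AlbertChib.discordantSq_eq_sum, AlbertChib.quad_eq_sum, Matrix.of_apply]
    rw [integral_finsetSum _ fun k _ => integrable_finsetSum _ fun l _ =>
      (hentry j k l).mul_const _]
    refine Finset.sum_congr rfl fun k _ => ?_
    rw [integral_finsetSum _ fun l _ => (hentry j k l).mul_const _]
    exact Finset.sum_congr rfl fun l _ => integral_mul_const _ _
  obtain ⟨ρ, hρ, hrate⟩ := AlbertChib.exists_eventually_rate_le hQ' v
    (Matrix.of fun k l => ∫ ω, X 0 ω k * X 0 ω l ∂P) hpos'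
  refine ⟨ρ, hρ, ?_⟩
  have h1 : ∀ᵐ ω ∂P, ∀ j k l, Tendsto (fun n : ℕ =>
      (∑ i : Fin n, AlbertChib.discordantEntry j k l (D i ω)) / n) atTop
      (nhds (∫ ω, AlbertChib.discordantEntry j k l (D 0 ω) ∂P)) := by
    simp_rw [ae_all_iff]
    exact fun j k l => AlbertChib.ae_tendsto_average hindep hident
      (AlbertChib.measurable_discordantEntry j k l) (hentry j k l)
  have h2 : ∀ᵐ ω ∂P, ∀ k l, Tendsto (fun n : ℕ => (∑ i : Fin n, X i ω k * X i ω l) / n) atTop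
      (nhds (∫ ω, X 0 ω k * X 0 ω l ∂P)) := by
    simp_rw [ae_all_iff]
    exact fun k l => AlbertChib.ae_tendsto_average hindep hident
      (f := fun d : AlbertChib.E p × Bool => d.1 k * d.1 l) (by fun_prop) (hint k l)
  filter_upwards [h1, h2] with ω h1 h2
  -- A real `limsup` is meaningful only for a sequence that does not escape to `-∞`, hence the lower
  -- bound 0.
  exact limsup_le_of_le
    (isCoboundedUnder_le_of_le atTop (x := 0) fun n => AlbertChib.rate_nonneg _ _ _ _)
    (hrate (fun i => X i ω) (fun i => Y i ω) h1 h2)
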